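/- Propositional Boolean formulas are built from the constants $\mathrm{True}$, $\mathrm{False}$ and variables (whose names are binary strings) by $\neg,\wedge,\vee$. They are written as strings over a fixed finite alphabet $\Sigma$ (in prefix notation, a variable being a marker letter followed by the binary digits of its name). Let $\mathrm{SAT}\subseteq\Sigma^*$ be the set of strings that represent satisfiable formulas, and let $\overline{\mathrm{SAT}}=\Sigma^*\setminus\mathrm{SAT}$. Let $\Gamma$ be a finite alphabet. A set $S\subseteq\Gamma^*$ is *sparse* if there is a polynomial $q$ such that $\|\{x\in S : |x|\le n\}\|\le q(n)$ for every $n\in\{0,1,2,\dots\}$. We write $\overline{\mathrm{SAT}}\le_m^p S$ if there is a polynomial-time computable function $g:\Sigma^*\to\Gamma^*$ such that, for all $x\in\Sigma^*$, $x\in\overline{\mathrm{SAT}}\iff g(x)\in S$. Polynomial time means time polynomial in the length of the input on a deterministic Turing machine. **Theorem (Fortune).** If there exists a sparse set $S\subseteq\Gamma^*$ such that $\overline{\mathrm{SAT}}\le_m^p S$, then $\mathrm{SAT}\in\mathrm{P}$. -/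

import Mathlib

open Turing Computability

namespace SparseSat

/-- Propositional Boolean formulas. The propositional variables are named by binary strings, so
there are infinitely many of them. -/
inductive BoolFormula : Type
  | const (b : Bool) : BoolFormula
  | var (name : List Bool) : BoolFormula
  | neg (φ : BoolFormula) : BoolFormula
  | conj (φ ψ : BoolFormula) : BoolFormula
  | disj (φ ψ : BoolFormula) : BoolFormula

/-- The eight-letter alphabet in which formulas are written: the two truth constants, the letter
that opens a variable, the two binary digits used in names of variables, and `¬`, `∧`, `∨`. -/
inductive FormulaSymbol : Type
  | const (b : Bool) : FormulaSymbol
  | var : FormulaSymbol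
  | digit (b : Bool) : FormulaSymbol
  | neg : FormulaSymbol
  | conj : FormulaSymbol
  | disj : FormulaSymbol
  deriving DecidableEq, Fintype

namespace BoolFormula

/-- The truth value of a formula under an assignment of truth values to the variables. -/
def eval (v : List Bool → Bool) : BoolFormula → Bool
  | const b => b
  | var x => v x
  | neg φ => !(eval v φ)
  | conj φ ψ => eval v φ && eval v ψ
  | disj φ ψ => eval v φ || eval v ψ

/-- A formula is satisfiable if some assignment makes it true. -/
def Satisfiable (φ : BoolFormula) : Prop :=
  ∃ v : List Bool → Bool, φ.eval v = true

/-- The string that represents a formula: prefix (Polish) notation, in which a variable is the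
letter `var` followed by the digits of its name. -/
def encode : BoolFormula → List FormulaSymbol
  | const b => [FormulaSymbol.const b]
  | var x => FormulaSymbol.var :: x.map FormulaSymbol.digit
  | neg φ => FormulaSymbol.neg :: encode φ
  | conj φ ψ => FormulaSymbol.conj :: (encode φ ++ encode ψ)
  | disj φ ψ => FormulaSymbol.disj :: (encode φ ++ encode ψ)

/-- An encoded formula does not begin with a digit. -/
theorem head?_encode_append (φ : BoolFormula) (s : List FormulaSymbol) (b : Bool) :
    (φ.encode ++ s).head? ≠ some (FormulaSymbol.digit b) := by
  cases φ <;> simp [encode]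

/-- Unique readability, in the form in which it is proved by induction. -/
theorem encode_append_cancel (φ : BoolFormula) : ∀ (ψ : BoolFormula) (s t : List FormulaSymbol),
    (∀ b, s.head? ≠ some (FormulaSymbol.digit b)) →
    (∀ b, t.head? ≠ some (FormulaSymbol.digit b)) →
    φ.encode ++ s = ψ.encode ++ t → φ = ψ ∧ s = t := by
  induction φ with
  | const b => intro ψ s t _ _ h; cases ψ <;> simp_all [encode]
  | var x =>
    intro ψ s t hs ht h
    cases ψ with
    | var y =>
      simp only [encode, List.cons_append, List.cons.injEq, true_and, var.injEq] at h ⊢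
      induction x generalizing y with
      | nil =>
        cases y with
        | nil => simpa using h
        | cons b y => exact absurd (by simp_all) (hs b)
      | cons a x ih =>
        cases y with
        | nil => exact absurd (by simp [← (show _ = t from by simpa using h)]) (ht a)
        | cons b y =>
          simp only [List.map_cons, List.cons_append, List.cons.injEq,
            FormulaSymbol.digit.injEq] at h ⊢
          exact ⟨⟨h.1, (ih y h.2).1⟩, (ih y h.2).2⟩
    | _ => simp [encode] at h
  | neg φ ih =>
    intro ψ s t hs ht h
    cases ψ with
    | neg ψ =>
      simp only [encode, List.cons_append, List.cons.injEq, true_and] at h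
      simpa using ih ψ s t hs ht h
    | _ => simp [encode] at h
  | conj φ₁ φ₂ ih₁ ih₂ =>
    intro ψ s t hs ht h
    cases ψ with
    | conj ψ₁ ψ₂ =>
      simp only [encode, List.cons_append, List.cons.injEq, true_and, List.append_assoc] at h
      obtain ⟨rfl, h'⟩ := ih₁ ψ₁ _ _ (head?_encode_append _ _) (head?_encode_append _ _) h
      simpa using ih₂ ψ₂ s t hs ht h'
    | _ => simp [encode] at h
  | disj φ₁ φ₂ ih₁ ih₂ =>
    intro ψ s t hs ht h
    cases ψ with
    | disj ψ₁ ψ₂ =>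
      simp only [encode, List.cons_append, List.cons.injEq, true_and, List.append_assoc] at h
      obtain ⟨rfl, h'⟩ := ih₁ ψ₁ _ _ (head?_encode_append _ _) (head?_encode_append _ _) h
      simpa using ih₂ ψ₂ s t hs ht h'
    | _ => simp [encode] at h

/-- Unique readability: distinct formulas are represented by distinct strings. -/
theorem encode_injective : Function.Injective encode := fun φ ψ h =>
  (encode_append_cancel φ ψ [] [] (by simp) (by simp) (by simpa using h)).1

end BoolFormula

/-- `SAT`: the set of (strings that represent) satisfiable Boolean formulas. Its complement
consists of the unsatisfiable formulas and of the strings that represent no formula. -/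
def SAT : Language FormulaSymbol :=
  {w : List FormulaSymbol | ∃ φ : BoolFormula, φ.encode = w ∧ φ.Satisfiable}

/-- A function on strings is polynomial-time computable if some (multi-stack) Turing machine
computes it within a number of steps polynomial in the length of the input. -/
def PolyTimeComputable {A B : Type} (g : List A → List B) : Prop :=
  Nonempty (TM2ComputableInPolyTime (id : List A → List A) (id : List B → List B) g)

/-- A language is in `P` if membership in it is decided by some Turing machine within a number of
steps polynomial in the length of the input. -/
def InP {A : Type} (L : Language A) : Prop :=
  ∃ f : List A → Bool, (∀ x, f x = true ↔ x ∈ L) ∧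
    Nonempty (TM2ComputableInPolyTime (id : List A → List A) encodeBool f)

/-- Many-one polynomial-time reducibility of `L` to `M`. -/
def PolyManyOneReducible {A B : Type} (L : Language A) (M : Language B) : Prop :=
  ∃ g : List A → List B, PolyTimeComputable g ∧ ∀ x, x ∈ L ↔ g x ∈ M

/-- A language is sparse if the number of its strings of length at most `n` is bounded by a
polynomial in `n`. -/
def Sparse {A : Type} (S : Language A) : Prop :=
  ∃ q : Polynomial ℕ, ∀ n : ℕ,
    {x : List A | x ∈ S ∧ x.length ≤ n}.encard ≤ (q.eval n : ℕ)

end SparseSat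

namespace SparseSat

set_option linter.unusedSectionVars false

/-! SAT is self-reducible. Replacing the first variable of a string by the two constants gives two
children that are not longer than it and contain fewer occurrences of variables, and the string is
satisfiable exactly when one of them is (`mem_SAT_of_substString`, `exists_substString_mem_SAT`,
`varCount_subst_lt`). The tree of substitutions may be exponentially large, so it is pruned by the
labels `g χ`: a label in `S` certifies that every string carrying it is unsatisfiable, and by
sparseness only polynomially many labels of the relevant length lie in `S`.

The machine keeps a list of labels known to lie in `S` and descends from the input `w`, always to a
child whose label is not listed. A true leaf proves `w` satisfiable. A leaf that is not true, and a
string both of whose children have listed labels, are unsatisfiable. If that happens at the root,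
the answer is no. Elsewhere the label of the string lies in `S` and is new: the string was entered
only because its label was not listed, and the list does not change during a descent. The label is
recorded and the search restarts from `w`, so no recursion stack is needed.

A descent visits at most `|w| + 1` strings, since each step removes a variable occurrence
(`reaches_round`). Every restart lengthens a duplicate-free list of short elements of `S`, so the
census of `S` bounds the number of descents (`Admissible.card_le`, `reaches_answer`).

The time bound is proved for a concrete multi-stack machine, `machine`, which runs the machine of
`g` as a subroutine (`reachesWithin_embed`). Labels are polynomially long because a machine pushes
boundedly many symbols per step (`length_output_le`). Malformed strings need no separate treatment:
their evaluation never ends in the one-element stack `[true]` (`mem_SAT_iff`). -/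

/-! ### Tokens, and evaluation of arbitrary strings -/

/-- A token: a symbol together with the digits that follow it. -/
abbrev Token := FormulaSymbol × List Bool

/-- The string spelled by a list of tokens. -/
def flat (ts : List Token) : List FormulaSymbol :=
  ts.flatMap fun t => t.1 :: t.2.map FormulaSymbol.digit

/-- The digits at the start of a string, and the tokens that follow them. -/
def tokenize : List FormulaSymbol → List Bool × List Token
  | [] => ([], [])
  | .digit d :: l => (d :: (tokenize l).1, (tokenize l).2)
  | s :: l => ([], (s, (tokenize l).1) :: (tokenize l).2)

/-- The string spelled by some digits followed by some tokens. -/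
def spell (p : List Bool × List Token) : List FormulaSymbol :=
  p.1.map FormulaSymbol.digit ++ flat p.2

/-- A symbol is a digit. -/
def FormulaSymbol.IsDigit (s : FormulaSymbol) : Prop := ∃ d, s = .digit d

/-- No token starts with a digit. -/
def Proper (ts : List Token) : Prop := ∀ t ∈ ts, ¬ t.1.IsDigit

@[simp] theorem flat_nil : flat [] = [] := rfl

@[simp] theorem flat_cons (t : Token) (ts : List Token) :
    flat (t :: ts) = t.1 :: (t.2.map FormulaSymbol.digit ++ flat ts) := rfl

@[simp] theorem flat_append (ts us : List Token) : flat (ts ++ us) = flat ts ++ flat us := by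
  simp [flat]

theorem tokenize_cons {s : FormulaSymbol} (h : ¬ s.IsDigit) (l : List FormulaSymbol) :
    tokenize (s :: l) = ([], (s, (tokenize l).1) :: (tokenize l).2) := by
  cases s <;> first | rfl | exact absurd ⟨_, rfl⟩ h

theorem spell_tokenize (l : List FormulaSymbol) : spell (tokenize l) = l := by
  induction l with
  | nil => rfl
  | cons s l ih =>
    by_cases h : s.IsDigit
    · obtain ⟨d, rfl⟩ := h
      simpa [tokenize, spell] using ih
    · simpa [tokenize_cons h, spell] using ih

theorem proper_tokenize (l : List FormulaSymbol) : Proper (tokenize l).2 := by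
  induction l with
  | nil => simp [tokenize, Proper]
  | cons s l ih =>
    by_cases h : s.IsDigit
    · obtain ⟨d, rfl⟩ := h
      simpa [tokenize] using ih
    · simpa [tokenize_cons h, Proper, h] using ih

/-- Properness is what makes this inverse to `spell_tokenize`: a token starting with a digit would
be absorbed by the digits before it. -/
theorem tokenize_spell (ds : List Bool) {ts : List Token} (h : Proper ts) :
    tokenize (spell (ds, ts)) = (ds, ts) := by
  induction ds with
  | cons d ds ih =>
    have : spell (d :: ds, ts) = .digit d :: spell (ds, ts) := rfl
    rw [this, tokenize, ih]
  | nil =>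
    induction ts with
    | nil => rfl
    | cons t ts ih =>
      simp only [Proper, List.forall_mem_cons] at h
      -- The induction hypothesis has no digits in front of `flat ts`, whereas the digits of `t` are
      -- needed there.
      have aux : ∀ ds : List Bool,
          tokenize (ds.map FormulaSymbol.digit ++ flat ts) = (ds, ts) := by
        intro ds
        induction ds with
        | nil => simpa [spell] using ih h.2
        | cons d ds ihd => simp [tokenize, ihd]
      simp [spell, tokenize_cons h.1, aux]

/-- One step of the evaluation, from the right, of a string in prefix notation: the values of the
formulas to the right are kept in a stack, and `none` records that the string is malformed. -/
def pushValue : FormulaSymbol → Option (List Bool) → Option (List Bool)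
  | .const b, some st => some (b :: st)
  | .neg, some (a :: st) => some ((!a) :: st)
  | .conj, some (a :: b :: st) => some ((a && b) :: st)
  | .disj, some (a :: b :: st) => some ((a || b) :: st)
  | _, _ => none

/-- The effect of a token on the evaluation stack. -/
def Token.push (v : List Bool → Bool) (t : Token) (o : Option (List Bool)) : Option (List Bool) :=
  if t.1 = .var then o.map (v t.2 :: ·) else if t.2 = [] then pushValue t.1 o else none

/-- The evaluation stack of a list of tokens. -/
def evalTokens (v : List Bool → Bool) (ts : List Token) : Option (List Bool) :=
  ts.foldr (Token.push v) (some [])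

/-- The evaluation stack of a string. -/
def evalString (v : List Bool → Bool) (w : List FormulaSymbol) : Option (List Bool) :=
  if (tokenize w).1 = [] then evalTokens v (tokenize w).2 else none

/-- The tokens of a formula. -/
def BoolFormula.tokens : BoolFormula → List Token
  | .const b => [(.const b, [])]
  | .var x => [(.var, x)]
  | .neg φ => (.neg, []) :: φ.tokens
  | .conj φ ψ => (.conj, []) :: (φ.tokens ++ ψ.tokens)
  | .disj φ ψ => (.disj, []) :: (φ.tokens ++ ψ.tokens)

theorem BoolFormula.flat_tokens (φ : BoolFormula) : flat φ.tokens = φ.encode := by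
  induction φ <;> simp_all [tokens, encode]

theorem BoolFormula.proper_tokens (φ : BoolFormula) : Proper φ.tokens := by
  induction φ <;>
    simp_all [tokens, Proper, FormulaSymbol.IsDigit, or_imp, forall_and] <;> tauto

theorem BoolFormula.tokenize_encode (φ : BoolFormula) : tokenize φ.encode = ([], φ.tokens) := by
  have := tokenize_spell [] φ.proper_tokens
  simpa [spell, φ.flat_tokens] using this

/-- Tokens to the right must be allowed for the induction: in a binary connective the first argument
is evaluated on top of the value of the second. -/
theorem evalTokens_tokens_append (v : List Bool → Bool) (φ : BoolFormula) :
    ∀ (ts : List Token) (st : List Bool), evalTokens v ts = some st →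
      evalTokens v (φ.tokens ++ ts) = some (φ.eval v :: st) := by
  induction φ with
  | const b =>
    intro ts st h
    have : evalTokens v ((.const b, []) :: ts) =
      Token.push v (.const b, []) (evalTokens v ts) := rfl
    simp [BoolFormula.tokens, this, h, Token.push, pushValue, BoolFormula.eval]
  | var x =>
    intro ts st h
    have : evalTokens v ((.var, x) :: ts) = Token.push v (.var, x) (evalTokens v ts) := rfl
    simp [BoolFormula.tokens, this, h, Token.push, BoolFormula.eval]
  | neg φ ih =>
    intro ts st h
    have : evalTokens v ((.neg, []) :: (φ.tokens ++ ts)) =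
      Token.push v (.neg, []) (evalTokens v (φ.tokens ++ ts)) := rfl
    simp [BoolFormula.tokens, this, ih ts st h, Token.push, pushValue, BoolFormula.eval]
  | conj φ ψ ih₁ ih₂ =>
    intro ts st h
    have : evalTokens v ((.conj, []) :: (φ.tokens ++ (ψ.tokens ++ ts))) =
      Token.push v (.conj, []) (evalTokens v (φ.tokens ++ (ψ.tokens ++ ts))) := rfl
    simp [BoolFormula.tokens, this, ih₁ _ _ (ih₂ ts st h), Token.push, pushValue, BoolFormula.eval]
  | disj φ ψ ih₁ ih₂ =>
    intro ts st h
    have : evalTokens v ((.disj, []) :: (φ.tokens ++ (ψ.tokens ++ ts))) =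
      Token.push v (.disj, []) (evalTokens v (φ.tokens ++ (ψ.tokens ++ ts))) := rfl
    simp [BoolFormula.tokens, this, ih₁ _ _ (ih₂ ts st h), Token.push, pushValue, BoolFormula.eval]

/-- Converse of `evalTokens_tokens_append`: evaluation succeeds only if every connective finds its
arguments on the stack, so each stack entry can be traced back to a formula. A stack of height one
then means a single formula. -/
theorem exists_formulas_of_evalTokens (v : List Bool → Bool) (ts : List Token) :
    ∀ st, evalTokens v ts = some st →
      ∃ l : List BoolFormula, ts = l.flatMap BoolFormula.tokens ∧ st = l.map (·.eval v) := by
  induction ts with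
  | nil =>
    intro st h
    exact ⟨[], rfl, by simpa [evalTokens] using h.symm⟩
  | cons t ts ih =>
    intro st h
    obtain ⟨s, ds⟩ := t
    have h' : Token.push v (s, ds) (evalTokens v ts) = some st := h
    cases ho : evalTokens v ts with
    | none =>
      rw [ho] at h'
      cases s <;> simp [Token.push, pushValue] at h'
    | some st' =>
      obtain ⟨l, hl, hst⟩ := ih st' ho
      rw [ho] at h'
      cases s with
      | var =>
        refine ⟨.var ds :: l, by simp [BoolFormula.tokens, hl], ?_⟩
        simpa [Token.push, hst, BoolFormula.eval] using h'.symm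
      | digit b => simp [Token.push, pushValue] at h'
      | const b =>
        simp only [Token.push, pushValue] at h'
        obtain rfl : ds = [] := by by_contra hd; simp [hd] at h'
        refine ⟨.const b :: l, by simp [BoolFormula.tokens, hl], ?_⟩
        simpa [hst, BoolFormula.eval] using h'.symm
      | neg =>
        simp only [Token.push] at h'
        obtain rfl : ds = [] := by by_contra hd; simp [hd] at h'
        match l, hl, hst with
        | [], _, hst => simp [hst, pushValue] at h'
        | φ :: l, hl, hst =>
          refine ⟨.neg φ :: l, by simp [BoolFormula.tokens, hl], ?_⟩
          simpa [hst, pushValue, BoolFormula.eval] using h'.symm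
      | conj =>
        simp only [Token.push] at h'
        obtain rfl : ds = [] := by by_contra hd; simp [hd] at h'
        match l, hl, hst with
        | [], _, hst => simp [hst, pushValue] at h'
        | [φ], _, hst => simp [hst, pushValue] at h'
        | φ :: ψ :: l, hl, hst =>
          refine ⟨.conj φ ψ :: l, by simp [BoolFormula.tokens, hl], ?_⟩
          simpa [hst, pushValue, BoolFormula.eval] using h'.symm
      | disj =>
        simp only [Token.push] at h'
        obtain rfl : ds = [] := by by_contra hd; simp [hd] at h'
        match l, hl, hst with
        | [], _, hst => simp [hst, pushValue] at h'
        | [φ], _, hst => simp [hst, pushValue] at h'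
        | φ :: ψ :: l, hl, hst =>
          refine ⟨.disj φ ψ :: l, by simp [BoolFormula.tokens, hl], ?_⟩
          simpa [hst, pushValue, BoolFormula.eval] using h'.symm

/-- Removes formulas from the problem: from here on, membership in SAT concerns only the evaluation
of strings, well-formed or not. -/
theorem mem_SAT_iff (w : List FormulaSymbol) :
    w ∈ SAT ↔ ∃ v, evalString v w = some [true] := by
  constructor
  · rintro ⟨φ, rfl, v, hv⟩
    refine ⟨v, ?_⟩
    have := evalTokens_tokens_append v φ [] [] rfl
    simpa [evalString, φ.tokenize_encode, hv] using this
  · rintro ⟨v, hv⟩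
    by_cases h : (tokenize w).1 = []
    · rw [evalString, if_pos h] at hv
      obtain ⟨l, hl, hst⟩ := exists_formulas_of_evalTokens v _ _ hv
      match l, hl, hst with
      | [], _, hst => simp at hst
      | [φ], hl, hst =>
        refine ⟨φ, ?_, v, by simpa using hst.symm⟩
        rw [← φ.flat_tokens, ← spell_tokenize w]
        simp [spell, h, hl]
      | _ :: _ :: _, _, hst => simp at hst
    · simp [evalString, h] at hv

/-! ### Substitution and self-reducibility -/

/-- Replaces the variable `x` by the constant `b` in a token. -/
def Token.subst (x : List Bool) (b : Bool) (t : Token) : Token :=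
  if t = (.var, x) then (.const b, []) else t

/-- Replaces the variable `x` by the constant `b` in a string. -/
def substString (x : List Bool) (b : Bool) (w : List FormulaSymbol) : List FormulaSymbol :=
  spell ((tokenize w).1, (tokenize w).2.map (Token.subst x b))

/-- The name of the first variable in a list of tokens. -/
def firstVar : List Token → Option (List Bool)
  | [] => none
  | (s, ds) :: ts => if s = .var then some ds else firstVar ts

/-- The number of occurrences of variables in a list of tokens. -/
def varCount (ts : List Token) : ℕ := ts.countP fun t => t.1 = .var

theorem Proper.map_subst {ts : List Token} (h : Proper ts) (x : List Bool) (b : Bool) :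
    Proper (ts.map (Token.subst x b)) := by
  intro t ht
  obtain ⟨t', ht', rfl⟩ := List.mem_map.1 ht
  unfold Token.subst
  split
  · rintro ⟨d, hd⟩
    cases hd
  · exact h _ ht'

theorem tokenize_substString (x : List Bool) (b : Bool) (w : List FormulaSymbol) :
    tokenize (substString x b w) = ((tokenize w).1, (tokenize w).2.map (Token.subst x b)) :=
  tokenize_spell _ ((proper_tokenize w).map_subst x b)

theorem Token.push_subst (v : List Bool → Bool) (x : List Bool) (b : Bool) (t : Token) :
    Token.push v (t.subst x b) = Token.push (Function.update v x b) t := by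
  obtain ⟨s, ds⟩ := t
  funext o
  by_cases h : (s, ds) = (FormulaSymbol.var, x)
  · obtain ⟨rfl, rfl⟩ := Prod.mk.inj h
    cases o <;> simp [Token.subst, Token.push, pushValue]
  · simp only [Token.subst, if_neg h, Token.push]
    split
    · rename_i hs
      have : ds ≠ x := by rintro rfl; exact h (by rw [hs])
      simp [Function.update_of_ne this]
    · rfl

/-- Substitution in the string is the same as updating the assignment, token by token. Both
directions of self-reducibility follow, also for malformed strings. -/
theorem evalString_substString (v : List Bool → Bool) (x : List Bool) (b : Bool)
    (w : List FormulaSymbol) :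
    evalString v (substString x b w) = evalString (Function.update v x b) w := by
  simp only [evalString, tokenize_substString, evalTokens, List.foldr_map, Token.push_subst]

theorem mem_SAT_of_substString {x : List Bool} {b : Bool} {w : List FormulaSymbol}
    (h : substString x b w ∈ SAT) : w ∈ SAT := by
  rw [mem_SAT_iff] at h ⊢
  obtain ⟨v, hv⟩ := h
  exact ⟨_, (evalString_substString v x b w).symm.trans hv⟩

theorem exists_substString_mem_SAT (x : List Bool) {w : List FormulaSymbol} (h : w ∈ SAT) :
    ∃ b, substString x b w ∈ SAT := by
  obtain ⟨v, hv⟩ := (mem_SAT_iff w).1 h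
  -- For `b = v x` the updated assignment is `v` itself.
  refine ⟨v x, (mem_SAT_iff _).2 ⟨v, ?_⟩⟩
  rwa [evalString_substString, Function.update_eq_self]

theorem length_substString_le (x : List Bool) (b : Bool) (w : List FormulaSymbol) :
    (substString x b w).length ≤ w.length := by
  conv_rhs => rw [← spell_tokenize w]
  simp only [substString, spell, List.length_append, List.length_map, add_le_add_iff_left]
  induction (tokenize w).2 with
  | nil => simp
  | cons t ts ih =>
    simp only [List.map_cons, flat_cons, List.length_cons, List.length_append, List.length_map]
    have : (t.subst x b).2.length ≤ t.2.length := by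
      unfold Token.subst
      split <;> simp
    omega

/-- The first variable itself is replaced, and no token turns into a variable. This is the measure
that bounds the length of a descent. -/
theorem varCount_subst_lt {ts : List Token} {x : List Bool} (h : firstVar ts = some x) (b : Bool) :
    varCount (ts.map (Token.subst x b)) < varCount ts := by
  have le : ∀ us : List Token, varCount (us.map (Token.subst x b)) ≤ varCount us := by
    intro us
    simp only [varCount, List.countP_map]
    refine List.countP_mono_left fun t _ ht => ?_
    by_contra hs
    have : t ≠ (.var, x) := by rintro rfl; simp at hs
    simp [Token.subst, this] at ht
    simp [ht] at hs
  induction ts with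
  | nil => simp [firstVar] at h
  | cons t ts ih =>
    obtain ⟨s, ds⟩ := t
    by_cases hs : s = .var
    · subst hs
      obtain rfl : ds = x := by simpa [firstVar] using h
      have := le ts
      simp only [varCount, List.map_cons, List.countP_cons] at this ⊢
      simp [Token.subst, -List.countP_map]
      omega
    · have h' := ih (by simpa [firstVar, hs] using h)
      simp only [varCount, List.map_cons, List.countP_cons] at h' ⊢
      simp [Token.subst, hs, -List.countP_map]
      exact h'

theorem varCount_le (w : List FormulaSymbol) : varCount (tokenize w).2 ≤ w.length := by
  conv_rhs => rw [← spell_tokenize w]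
  refine List.countP_le_length.trans ?_
  simp only [spell, List.length_append]
  refine le_trans ?_ (Nat.le_add_left _ _)
  induction (tokenize w).2 with
  | nil => simp
  | cons t ts ih => simp; omega

/-! ### Evaluation of the leaves -/

/-- The evaluation stack of a string without variables. -/
def evalClosed (w : List FormulaSymbol) : Option (List Bool) := w.foldr pushValue (some [])

theorem foldr_pushValue_none (l : List FormulaSymbol) : l.foldr pushValue none = none := by
  induction l with
  | nil => rfl
  | cons s l ih => rw [List.foldr_cons, ih]; cases s <;> rfl

theorem foldr_pushValue_digits (ds : List Bool) (h : ds ≠ []) (o : Option (List Bool)) :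
    (ds.map FormulaSymbol.digit).foldr pushValue o = none := by
  cases ds with
  | nil => exact absurd rfl h
  | cons d ds =>
    rw [List.map_cons, List.foldr_cons]
    cases (List.map _ ds).foldr pushValue o <;> rfl

/-- Without variables every digit is an error, and `pushValue` fails on digits too. Hence a leaf can
be evaluated symbol by symbol, without forming tokens. -/
theorem evalString_eq_evalClosed {w : List FormulaSymbol} (h : firstVar (tokenize w).2 = none)
    (v : List Bool → Bool) : evalString v w = evalClosed w := by
  have key : ∀ ts : List Token, firstVar ts = none →
      (flat ts).foldr pushValue (some []) = evalTokens v ts := by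
    intro ts
    induction ts with
    | nil => intro _; rfl
    | cons t ts ih =>
      obtain ⟨s, ds⟩ := t
      intro hts
      have hs : s ≠ .var := by rintro rfl; simp [firstVar] at hts
      have ih' := ih (by simpa [firstVar, hs] using hts)
      have : evalTokens v ((s, ds) :: ts) = Token.push v (s, ds) (evalTokens v ts) := rfl
      rw [this, ← ih', flat_cons, List.foldr_cons, List.foldr_append]
      by_cases hd : ds = []
      · subst hd; simp [Token.push, hs]
      · rw [foldr_pushValue_digits ds hd]
        simp only [Token.push, hs, hd, if_false]
        cases s <;> rfl
  conv_rhs => rw [← spell_tokenize w]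
  unfold evalString evalClosed spell
  rw [List.foldr_append, key _ h]
  split
  · rename_i h0; simp [h0]
  · rename_i h0; rw [foldr_pushValue_digits _ h0]

theorem mem_SAT_iff_evalClosed {w : List FormulaSymbol} (h : firstVar (tokenize w).2 = none) :
    w ∈ SAT ↔ evalClosed w = some [true] := by
  rw [mem_SAT_iff]
  simp [evalString_eq_evalClosed h]

/-! ### Reachability with time bounds -/

/-- `f` leads from `a` to `b` in at most `t` steps. -/
def ReachesWithin {α : Type*} (f : α → Option α) (t : ℕ) (a b : α) : Prop :=
  ∃ n ≤ t, (flip bind f)^[n] (some a) = some b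

namespace ReachesWithin

variable {α : Type*} {f : α → Option α} {a b c : α} {t u : ℕ}

theorem refl (t : ℕ) (a : α) : ReachesWithin f t a a := ⟨0, Nat.zero_le _, rfl⟩

theorem single (h : f a = some b) : ReachesWithin f 1 a b := ⟨1, le_rfl, h⟩

theorem mono (h : ReachesWithin f t a b) (htu : t ≤ u) : ReachesWithin f u a b :=
  let ⟨n, hn, e⟩ := h
  ⟨n, hn.trans htu, e⟩

theorem congr {b' : α} (h : ReachesWithin f t a b) (hb : b = b') (htu : t ≤ u) :
    ReachesWithin f u a b' :=
  hb ▸ h.mono htu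

theorem trans (h₁ : ReachesWithin f t a b) (h₂ : ReachesWithin f u b c) :
    ReachesWithin f (t + u) a c := by
  obtain ⟨n, hn, e₁⟩ := h₁
  obtain ⟨m, hm, e₂⟩ := h₂
  exact ⟨m + n, by omega, by rw [Function.iterate_add_apply, e₁, e₂]⟩

theorem head (h₁ : f a = some b) (h₂ : ReachesWithin f t b c) : ReachesWithin f (t + 1) a c :=
  ((single h₁).trans h₂).mono (by omega)

theorem tail (h₁ : ReachesWithin f t a b) (h₂ : f b = some c) : ReachesWithin f (t + 1) a c :=
  h₁.trans (single h₂)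

end ReachesWithin

/-! ### Branching on a stack symbol -/

section Case

open TM2 TM2.Stmt

variable {K : Type} [DecidableEq K] {A : K → Type} {Λ T σ : Type}

open scoped Classical in
/-- Branches on the content of the scratch register, which it clears. -/
noncomputable def select {α : Type} [Finite α] (enc : α → T)
    (q : α → Stmt A Λ (Option T × σ)) : Stmt A Λ (Option T × σ) :=
  (@Finset.univ α (Fintype.ofFinite α)).toList.foldr (fun a r => branch
    (fun v => decide (v.1 = some (enc a))) (load (fun v => (none, v.2)) (q a)) r) halt

/-- A statement sees a popped symbol only through the internal state, so the case distinction is a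
finite chain of tests of the register. Clearing the register afterwards gives all configurations
between steps the same form. -/
theorem stepAux_select {α : Type} [Finite α] {enc : α → T} (henc : enc.Injective)
    (q : α → Stmt A Λ (Option T × σ)) (a : α) (s : σ) (S : ∀ k, List (A k)) :
    stepAux (select enc q) (some (enc a), s) S = stepAux (q a) (none, s) S := by
  classical
  have key : ∀ l : List α, a ∈ l → stepAux (l.foldr (fun a r => branch
      (fun v : Option T × σ => decide (v.1 = some (enc a))) (load (fun v => (none, v.2)) (q a)) r)
      halt) (some (enc a), s) S = stepAux (q a) (none, s) S := by
    intro l hl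
    induction l with
    | nil => simp at hl
    | cons b l ih =>
      by_cases h : a = b
      · subst h; simp
      · have hb : enc a ≠ enc b := fun e => h (henc e)
        simpa [hb] using ih (by simpa [h] using hl)
  exact key _ (by simp)

/-- Pops a symbol from the stack `k` and continues according to its value. -/
noncomputable def popCase (k : K) [Finite (A k)] (enc : Option (A k) → T)
    (q : Option (A k) → Stmt A Λ (Option T × σ)) : Stmt A Λ (Option T × σ) :=
  pop k (fun v a => (some (enc a), v.2)) (select enc q)

/-- Looks at the top symbol of the stack `k` and continues according to its value. -/
noncomputable def peekCase (k : K) [Finite (A k)] (enc : Option (A k) → T)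
    (q : Option (A k) → Stmt A Λ (Option T × σ)) : Stmt A Λ (Option T × σ) :=
  peek k (fun v a => (some (enc a), v.2)) (select enc q)

theorem stepAux_popCase {k : K} [Finite (A k)] {enc : Option (A k) → T} (henc : enc.Injective)
    (q : Option (A k) → Stmt A Λ (Option T × σ)) (v : Option T × σ) (S : ∀ k, List (A k)) :
    stepAux (popCase k enc q) v S =
      stepAux (q (S k).head?) (none, v.2) (Function.update S k (S k).tail) := by
  rw [popCase, stepAux, stepAux_select henc]

theorem stepAux_peekCase {k : K} [Finite (A k)] {enc : Option (A k) → T} (henc : enc.Injective)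
    (q : Option (A k) → Stmt A Λ (Option T × σ)) (v : Option T × σ) (S : ∀ k, List (A k)) :
    stepAux (peekCase k enc q) v S = stepAux (q (S k).head?) (none, v.2) S := by
  rw [peekCase, stepAux, stepAux_select henc]

end Case

/-! ### Output length is bounded by running time -/

section OutputLength

open TM2 TM2.Stmt

variable {K : Type} [DecidableEq K] {A : K → Type} {Λ σ : Type}

/-- The number of push commands in a statement. -/
def pushCount : Stmt A Λ σ → ℕ
  | push _ _ q => pushCount q + 1
  | peek _ _ q => pushCount q
  | pop _ _ q => pushCount q
  | load _ q => pushCount q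
  | branch _ q₁ q₂ => pushCount q₁ + pushCount q₂
  | goto _ => 0
  | halt => 0

theorem length_stepAux_le (k : K) (q : Stmt A Λ σ) : ∀ (v : σ) (S : ∀ k, List (A k)),
    ((stepAux q v S).stk k).length ≤ (S k).length + pushCount q := by
  induction q with
  | push k' f q ih =>
    intro v S
    refine (ih _ _).trans ?_
    rcases eq_or_ne k k' with rfl | h
    · simp [pushCount]; omega
    · simp [pushCount, Function.update_of_ne h]
  | peek k' f q ih => exact fun v S => ih _ _
  | pop k' f q ih =>
    intro v S
    refine (ih _ _).trans ?_
    rcases eq_or_ne k k' with rfl | h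
    · simp [pushCount]
    · simp [pushCount, Function.update_of_ne h]
  | load f q ih => exact fun v S => ih _ _
  | branch f q₁ q₂ ih₁ ih₂ =>
    intro v S
    simp only [stepAux, pushCount]
    have := ih₁ v S
    have := ih₂ v S
    cases f v <;> simp only [cond_true, cond_false] <;> omega
  | goto f => intro v S; simp [pushCount]
  | halt => intro v S; simp [pushCount]

/-- Each step executes the statement of one label, whose push count is at most the sum over all
labels. -/
theorem length_stk_le_of_iterate [Fintype Λ] (m : Λ → Stmt A Λ σ) (k : K) (n : ℕ) :
    ∀ {c c' : Cfg A Λ σ}, (flip bind (step m))^[n] (some c) = some c' →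
      (c'.stk k).length ≤ (c.stk k).length + n * ∑ l, pushCount (m l) := by
  induction n with
  | zero =>
    intro c c' h
    obtain rfl : c = c' := Option.some.inj h
    simp
  | succ n ih =>
    intro c c' h
    rw [Function.iterate_succ_apply'] at h
    cases hc : (flip bind (step m))^[n] (some c) with
    | none => rw [hc] at h; cases h
    | some d =>
      rw [hc] at h
      have hd : step m d = some c' := h
      have := ih hc
      obtain ⟨_ | l, v, S⟩ := d
      · simp at hd
      · obtain rfl : stepAux (m l) v S = c' := by simpa using hd
        have h1 := length_stepAux_le k (m l) v S
        have h2 : pushCount (m l) ≤ ∑ l, pushCount (m l) :=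
          Finset.single_le_sum (f := fun l => pushCount (m l)) (fun _ _ => Nat.zero_le _)
            (Finset.mem_univ l)
        simp only [] at this
        rw [Nat.succ_mul]
        omega

instance (tm : FinTM2) : Fintype tm.Λ := tm.ΛFin

instance (tm : FinTM2) : Fintype tm.K := tm.kFin

instance (tm : FinTM2) : Fintype tm.σ := tm.σFin

theorem initList_eq (tm : FinTM2) (s : List (tm.Γ tm.k₀)) :
    initList tm s = ⟨some tm.main, tm.initialState, Function.update (fun _ => []) tm.k₀ s⟩ := by
  unfold initList
  congr 1
  funext k
  by_cases h : k = tm.k₀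
  · subst h; simp
  · simp [h]

theorem haltList_eq (tm : FinTM2) (s : List (tm.Γ tm.k₁)) :
    haltList tm s = ⟨none, tm.initialState, Function.update (fun _ => []) tm.k₁ s⟩ := by
  unfold haltList
  congr 1
  funext k
  by_cases h : k = tm.k₁
  · subst h; simp
  · simp [h]

theorem length_output_le (tm : FinTM2) {s : List (tm.Γ tm.k₀)} {s' : List (tm.Γ tm.k₁)} {t : ℕ}
    (h : TM2OutputsInTime tm s (some s') t) :
    s'.length ≤ s.length + t * ∑ l, pushCount (tm.m l) := by
  have h1 := length_stk_le_of_iterate tm.m tm.k₁ h.steps h.evals_in_steps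
  have h2 : h.steps * ∑ l, pushCount (tm.m l) ≤ t * ∑ l, pushCount (tm.m l) :=
    Nat.mul_le_mul_right _ h.steps_le_m
  have h3 : ((initList tm s).stk tm.k₁).length ≤ s.length := by
    rw [initList_eq]
    by_cases e : tm.k₁ = tm.k₀
    -- When input and output share a stack, the input counts towards its length. Quantifying over
    -- `k` avoids a transport along `tm.k₁ = tm.k₀`.
    · have : ∀ k, (Function.update (fun _ => [] : ∀ k, List (tm.Γ k)) tm.k₀ s k).length
          ≤ s.length := by
        intro k
        by_cases hk : k = tm.k₀
        · subst hk; simp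
        · simp [Function.update_of_ne hk]
      exact this _
    · simp [Function.update_of_ne e]
  have h4 : (haltList tm s').stk tm.k₁ = s' := by
    simp [haltList]
  have h5 : s'.length ≤ ((initList tm s).stk tm.k₁).length +
      h.steps * ∑ l, pushCount (tm.m l) :=
    (congrArg List.length h4).symm.le.trans h1
  omega

end OutputLength

/-! ### The decision machine -/

/-- The stacks of the decision machine, apart from those of the machine of the reduction. -/
inductive OwnStack
  | input | output | cur | child | rev | back | name | nameRev | values
  | label | labelRev | curLabel | known | knownRev
  deriving DecidableEq

instance : Fintype OwnStack where
  elems := {.input, .output, .cur, .child, .rev, .back, .name, .nameRev, .values,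
    .label, .labelRev, .curLabel, .known, .knownRev}
  complete k := by cases k <;> decide

/-- The alphabets of the stacks. -/
@[reducible]
def OwnStack.Alphabet (Γ : Type) : OwnStack → Type
  | input | cur | child | rev | back => FormulaSymbol
  | output | name | nameRev | values => Bool
  | label | labelRev | curLabel => Γ
  | known | knownRev => Option Γ

instance OwnStack.finite_alphabet (Γ : Type) [Finite Γ] (k : OwnStack) : Finite (k.Alphabet Γ) := by
  cases k <;> simp only [OwnStack.Alphabet] <;> infer_instance

/-- The contents of the stacks: the input string; the answer; the string `cur` reached in the
search; its child under consideration; the reversals of the two; the name of the first variable;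
the evaluation stack; the (reversed) labels of the child and of `cur`; and the list of the labels
that are known to belong to unsatisfiable strings. -/
structure Store (Γ : Type) where
  input : List FormulaSymbol := []
  output : List Bool := []
  cur : List FormulaSymbol := []
  child : List FormulaSymbol := []
  rev : List FormulaSymbol := []
  back : List FormulaSymbol := []
  name : List Bool := []
  nameRev : List Bool := []
  values : List Bool := []
  label : List Γ := []
  labelRev : List Γ := []
  curLabel : List Γ := []
  known : List (Option Γ) := []
  knownRev : List (Option Γ) := []

namespace Store

variable {Γ : Type}

/-- The content of a stack. -/
def get (s : Store Γ) : ∀ k : OwnStack, List (k.Alphabet Γ)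
  | .input => s.input
  | .output => s.output
  | .cur => s.cur
  | .child => s.child
  | .rev => s.rev
  | .back => s.back
  | .name => s.name
  | .nameRev => s.nameRev
  | .values => s.values
  | .label => s.label
  | .labelRev => s.labelRev
  | .curLabel => s.curLabel
  | .known => s.known
  | .knownRev => s.knownRev

/-- Changes the content of a stack. -/
def set (s : Store Γ) : ∀ k : OwnStack, List (k.Alphabet Γ) → Store Γ
  | .input, l => { s with input := l }
  | .output, l => { s with output := l }
  | .cur, l => { s with cur := l }
  | .child, l => { s with child := l }
  | .rev, l => { s with rev := l }
  | .back, l => { s with back := l }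
  | .name, l => { s with name := l }
  | .nameRev, l => { s with nameRev := l }
  | .values, l => { s with values := l }
  | .label, l => { s with label := l }
  | .labelRev, l => { s with labelRev := l }
  | .curLabel, l => { s with curLabel := l }
  | .known, l => { s with known := l }
  | .knownRev, l => { s with knownRev := l }

theorem get_set (s : Store Γ) (k k' : OwnStack) (l : List (k.Alphabet Γ)) :
    (s.set k l).get k' = Function.update s.get k l k' := by
  cases k <;> cases k' <;> rfl

end Store

/-- What happens after the stacks of a search have been cleared: the search goes on at the child,
starts again from the input, or ends with an answer. -/
inductive Target
  | enter
  | restart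
  | reply (answer : Bool)
  deriving Fintype

/-- The labels of the decision machine. The parameter `root` tells whether `cur` is the input, and
`b` is the constant that replaces the first variable. -/
inductive Label
  | unload
  | reload
  | scan (root : Bool) (phase : Option Bool)
  | evaluate (root closed ok : Bool)
  | flip (root : Bool)
  | subst (root b : Bool)
  | compare (root b same : Bool)
  | restore (root b same : Bool)
  | load (root b : Bool)
  | unback (root b : Bool)
  | ret (root b : Bool)
  | lookup (root b found : Bool)
  | lookupCompare (root b found same : Bool)
  | lookupRestore (root b found same : Bool)
  | unlookup (root b found : Bool)
  | drop (root b : Bool)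
  | wipe (target : Target)
  | keepLabel
  | record
  | finish (answer : Bool)
  deriving Fintype

section Machine

open TM2 TM2.Stmt

variable {Γ : Type} [Finite Γ] (c : TM2ComputableAux FormulaSymbol Γ)

/-- The alphabets of all stacks of the decision machine. -/
@[reducible]
def StackAlphabet : OwnStack ⊕ c.tm.K → Type
  | .inl k => k.Alphabet Γ
  | .inr k => c.tm.Γ k

/-- The internal states of the decision machine: a scratch register, and the internal state of the
machine of the reduction. -/
abbrev InternalState : Type := Option (Σ k : OwnStack, Option (k.Alphabet Γ)) × c.tm.σ

/-- The labels of the decision machine, including those of the machine of the reduction. -/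
abbrev AllLabel : Type := Label ⊕ (Bool × Bool) × c.tm.Λ

/-- The statements of the decision machine. -/
abbrev Code : Type := TM2.Stmt (StackAlphabet c) (AllLabel c) (InternalState c)

/-- The configurations of the decision machine. -/
abbrev Config : Type := TM2.Cfg (StackAlphabet c) (AllLabel c) (InternalState c)

variable {c}

/-- Pops a symbol and continues according to its value. -/
noncomputable def onPop (k : OwnStack) (q : Option (k.Alphabet Γ) → Code c) : Code c :=
  popCase (A := StackAlphabet c) (.inl k) (fun a => ⟨k, a⟩) q

/-- Looks at the top symbol of a stack and continues according to its value. -/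
noncomputable def onPeek (k : OwnStack) (q : Option (k.Alphabet Γ) → Code c) : Code c :=
  peekCase (A := StackAlphabet c) (.inl k) (fun a => ⟨k, a⟩) q


/-- Pushes a symbol. -/
def put (k : OwnStack) (a : k.Alphabet Γ) (q : Code c) : Code c :=
  push (Γ := StackAlphabet c) (.inl k) (fun _ => a) q

/-- Jumps to a label. -/
def jump (l : Label) : Code c := goto fun _ => .inl l

instance : Finite (c.tm.Γ c.tm.k₁) := .of_equiv _ c.outputAlphabet.symm

/-- Pops a symbol of the output of the reduction and continues according to its value. -/
noncomputable def onPopOutput (q : Option Γ → Code c) : Code c :=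
  popCase (A := StackAlphabet c) (.inr c.tm.k₁) (fun a => ⟨.label, a.map c.outputAlphabet⟩)
    fun a => q (a.map c.outputAlphabet)

/-- Pushes a symbol on the input stack of the reduction. -/
def putInput (a : FormulaSymbol) (q : Code c) : Code c :=
  push (Γ := StackAlphabet c) (.inr c.tm.k₀) (fun _ => c.inputAlphabet.symm a) q

/-- The statement executed when neither child needs to be searched. -/
def giveUp (root : Bool) : Code c :=
  if root then jump (.wipe (.reply false)) else jump .record

/-- The statements of the machine of the reduction, as statements of the decision machine. -/
def embedStmt (r b : Bool) : TM2.Stmt c.tm.Γ c.tm.Λ c.tm.σ → Code c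
  | push k f q => push (Γ := StackAlphabet c) (.inr k) (fun v => f v.2) (embedStmt r b q)
  | peek k f q =>
    peek (Γ := StackAlphabet c) (.inr k) (fun v a => (v.1, f v.2 a)) (embedStmt r b q)
  | pop k f q =>
    pop (Γ := StackAlphabet c) (.inr k) (fun v a => (v.1, f v.2 a)) (embedStmt r b q)
  | load f q => load (fun v => (v.1, f v.2)) (embedStmt r b q)
  | branch f q₁ q₂ => branch (fun v => f v.2) (embedStmt r b q₁) (embedStmt r b q₂)
  | goto f => goto fun v => .inr ((r, b), f v.2)
  | halt => jump (.ret r b)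

variable (c)

open scoped Classical in
/-- The program of the decision machine. -/
noncomputable def program : Label → Code c
  | .unload => onPop .input fun
    | none => jump .reload
    | some a => put .rev a (jump .unload)
  | .reload => onPop .rev fun
    | none => jump (.scan true none)
    | some a => put .input a (put .child a (jump .reload))
  -- The phase `p` is `none` before the first variable, `some true` while its name is read, and
  -- `some false` afterwards.
  | .scan r p => onPop .child fun
    | none => jump (.evaluate r p.isNone p.isNone)
    | some a => put .back a <| match a, p with
      | .var, none => jump (.scan r (some true))
      | .digit d, some true => put .nameRev d (jump (.scan r (some true)))
      | _, some true => jump (.scan r (some false))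
      | _, p => jump (.scan r p)
  -- `back` holds the string reversed, so it is evaluated from the right while being copied to
  -- `cur`. If there is a variable, `ok` is false from the start and only the copying remains.
  | .evaluate r closed ok => onPop .back fun
    | some a => put .cur a <| match a, ok with
      | .const b, true => put .values b (jump (.evaluate r closed true))
      | .neg, true => onPop .values fun
        | some x => put .values (!x) (jump (.evaluate r closed true))
        | none => jump (.evaluate r closed false)
      | .conj, true => onPop .values fun
        | some x => onPop .values fun
          | some y => put .values (x && y) (jump (.evaluate r closed true))
          | none => jump (.evaluate r closed false)
        | none => jump (.evaluate r closed false)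
      | .disj, true => onPop .values fun
        | some x => onPop .values fun
          | some y => put .values (x || y) (jump (.evaluate r closed true))
          | none => jump (.evaluate r closed false)
        | none => jump (.evaluate r closed false)
      | _, _ => jump (.evaluate r closed false)
    | none => match closed, ok with
      | true, true => onPop .values fun
        | some true => onPop .values fun
          | none => jump (.wipe (.reply true))
          | some _ => giveUp r
        | _ => giveUp r
      | true, false => giveUp r
      | false, _ => jump (.flip r)
  | .flip r => onPop .nameRev fun
    | none => jump (.subst r false)
    | some d => put .name d (jump (.flip r))
  -- `back` receives the unchanged string, from which `cur` is rebuilt for the second child; `rev`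
  -- receives the substituted string.
  | .subst r b => onPop .cur fun
    | none => jump (.load r b)
    | some a => put .back a <| put .rev a <|
      if a = .var then jump (.compare r b true) else jump (.subst r b)
  | .compare r b m => onPeek .cur fun
    | some (.digit d) => onPop .cur fun _ => put .back (.digit d) <| put .rev (.digit d) <|
      onPop .name fun
        | none => jump (.compare r b false)
        | some e => put .nameRev e (jump (.compare r b (m && d == e)))
    | _ => onPeek .name fun
      | none => jump (.restore r b m)
      | some _ => jump (.restore r b false)
  -- After a match, one symbol of `rev` is discarded for each digit of the name, and the last pop
  -- removes the letter `var`.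
  | .restore r b m => onPop .nameRev fun
    | some d => put .name d <|
      if m then onPop .rev fun _ => jump (.restore r b m) else jump (.restore r b m)
    | none => if m then onPop .rev fun _ => put .rev (.const b) (jump (.subst r b))
      else jump (.subst r b)
  | .load r b => onPop .rev fun
    | none => jump (.unback r b)
    | some a => put .child a (putInput a (jump (.load r b)))
  | .unback r b => onPop .back fun
    | none => goto fun _ => .inr ((r, b), c.tm.main)
    | some a => put .cur a (jump (.unback r b))
  | .ret r b => onPopOutput fun
    | none => jump (.lookup r b false)
    | some a => put .label a (jump (.ret r b))
  | .lookup r b f => onPop .known fun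
    | none => jump (.unlookup r b f)
    | some x => put .knownRev x (jump (.lookupCompare r b f true))
  | .lookupCompare r b f m => onPeek .known fun
    | some (some a) => onPop .known fun _ => put .knownRev (some a) <| onPop .label fun
      | none => jump (.lookupCompare r b f false)
      | some e => put .labelRev e (jump (.lookupCompare r b f (m && decide (a = e))))
    | _ => onPeek .label fun
      | none => jump (.lookupRestore r b f m)
      | some _ => jump (.lookupRestore r b f false)
  | .lookupRestore r b f m => onPop .labelRev fun
    | some a => put .label a (jump (.lookupRestore r b f m))
    | none => jump (.lookup r b (f || m))
  | .unlookup r b f => onPop .knownRev fun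
    | some x => put .known x (jump (.unlookup r b f))
    | none => if f then jump (.drop r b) else jump (.wipe .enter)
  | .drop r b => onPop .child fun x => onPop .label fun y =>
    if x.isNone && y.isNone then (if b then giveUp r else jump (.subst r true))
    else jump (.drop r b)
  | .wipe t => onPop .cur fun x => onPop .name fun y => onPop .values fun z =>
    onPop .curLabel fun u =>
      if x.isNone && y.isNone && z.isNone && u.isNone then match t with
        | .enter => jump .keepLabel
        | .restart => jump .unload
        | .reply a => jump (.finish a)
      else jump (.wipe t)
  | .keepLabel => onPop .label fun
    | none => jump (.scan false none)
    | some a => put .curLabel a (jump .keepLabel)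
  | .record => onPop .curLabel fun
    | none => put .known none (jump (.wipe .restart))
    | some a => put .known (some a) (jump .record)
  | .finish a => onPop .input fun x => onPop .known fun y =>
    if x.isNone && y.isNone then put .output a halt else jump (.finish a)

/-- The code of the decision machine. -/
noncomputable def code : AllLabel c → Code c
  | .inl l => program c l
  | .inr ((r, b), l) => embedStmt r b (c.tm.m l)

/-- The decision machine. -/
noncomputable def machine : FinTM2 where
  K := OwnStack ⊕ c.tm.K
  kFin := inferInstance
  k₀ := .inl .input
  k₁ := .inl .output
  Γ := StackAlphabet c
  Λ := AllLabel c
  main := .inl .unload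
  σ := InternalState c
  initialState := (none, c.tm.initialState)
  σFin := .ofFinite _
  Γk₀Fin := inferInstanceAs (Fintype FormulaSymbol)
  m := code c

end Machine

/-! ### Single steps, and simulation of the reduction -/

section Step

open TM2 TM2.Stmt

variable {Γ : Type} (c : TM2ComputableAux FormulaSymbol Γ)

/-- All stacks of the decision machine. -/
def allStacks (s : Store Γ) (t : ∀ k, List (c.tm.Γ k)) : ∀ k, List (StackAlphabet c k)
  | .inl k => s.get k
  | .inr k => t k

/-- The configuration at a label, outside of the machine of the reduction. -/
def config (l : Label) (s : Store Γ) : Config c :=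
  ⟨some (.inl l), (none, c.tm.initialState), allStacks c s fun _ => []⟩

variable {c}

theorem update_allStacks_inl (s : Store Γ) (t : ∀ k, List (c.tm.Γ k)) (k : OwnStack)
    (l : List (k.Alphabet Γ)) :
    Function.update (allStacks c s t) (.inl k) l = allStacks c (s.set k l) t := by
  funext k'
  rcases k' with k' | k'
  · rcases eq_or_ne k' k with rfl | h
    · simp [allStacks, Store.get_set]
    · rw [Function.update_of_ne (by simpa using h)]
      simp [allStacks, Store.get_set, Function.update_of_ne h]
  · rw [Function.update_of_ne (by simp)]
    rfl

theorem update_allStacks_inr (s : Store Γ) (t : ∀ k, List (c.tm.Γ k)) (k : c.tm.K)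
    (l : List (c.tm.Γ k)) :
    Function.update (allStacks c s t) (.inr k) l = allStacks c s (Function.update t k l) := by
  funext k'
  rcases k' with k' | k'
  · rw [Function.update_of_ne (by simp)]
    rfl
  · rcases eq_or_ne k' k with rfl | h
    · simp [allStacks]
    · rw [Function.update_of_ne (by simpa using h)]
      simp [allStacks, Function.update_of_ne h]

variable (s : Store Γ) (t : ∀ k, List (c.tm.Γ k)) (v : InternalState c)

@[simp]
theorem stepAux_jump (l : Label) :
    stepAux (jump l) (none, c.tm.initialState) (allStacks c s fun _ => []) = config c l s := rfl

/-- The configuration of the decision machine that corresponds to a configuration of the machine of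
the reduction. -/
def embedConfig (r b : Bool) (s : Store Γ) (d : TM2.Cfg c.tm.Γ c.tm.Λ c.tm.σ) : Config c :=
  ⟨some (d.l.elim (.inl (.ret r b)) fun l => .inr ((r, b), l)), (none, d.var), allStacks c s d.stk⟩

/-- The machine of the reduction touches only its own stacks and its own part of the internal state.
The pair `r`, `b` travels in the label as a return address, used when the simulated machine halts.
-/
theorem stepAux_embedStmt (r b : Bool) (q : TM2.Stmt c.tm.Γ c.tm.Λ c.tm.σ) :
    ∀ (x : c.tm.σ) (t : ∀ k, List (c.tm.Γ k)),
      stepAux (embedStmt r b q) (none, x) (allStacks c s t) =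
        embedConfig r b s (stepAux q x t) := by
  induction q with
  | push k f q ih =>
    intro x t
    rw [embedStmt, stepAux, stepAux, update_allStacks_inr, ← ih]
    rfl
  | peek k f q ih => exact fun x t => ih _ _
  | pop k f q ih =>
    intro x t
    rw [embedStmt, stepAux, stepAux, update_allStacks_inr, ← ih]
    rfl
  | load f q ih => exact fun x t => ih _ _
  | branch f q₁ q₂ ih₁ ih₂ =>
    intro x t
    simp only [embedStmt, stepAux]
    cases f x
    · exact ih₂ _ _
    · exact ih₁ _ _
  | goto f => exact fun x t => rfl
  | halt => exact fun x t => rfl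

variable [Finite Γ]

@[simp]
theorem stepAux_onPop (k : OwnStack) (q : Option (k.Alphabet Γ) → Code c) :
    stepAux (onPop k q) v (allStacks c s t) =
      stepAux (q (s.get k).head?) (none, v.2) (allStacks c (s.set k (s.get k).tail) t) := by
  rw [onPop, stepAux_popCase, ← update_allStacks_inl]
  · rfl
  · intro a b h
    simpa using h

@[simp]
theorem stepAux_onPeek (k : OwnStack) (q : Option (k.Alphabet Γ) → Code c) :
    stepAux (onPeek k q) v (allStacks c s t) =
      stepAux (q (s.get k).head?) (none, v.2) (allStacks c s t) := by
  rw [onPeek, stepAux_peekCase]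
  · rfl
  · intro a b h
    simpa using h

@[simp]
theorem stepAux_put (k : OwnStack) (a : k.Alphabet Γ) (q : Code c) :
    stepAux (put k a q) v (allStacks c s t) =
      stepAux q v (allStacks c (s.set k (a :: s.get k)) t) := by
  rw [put, stepAux, ← update_allStacks_inl]
  rfl

@[simp]
theorem stepAux_onPopOutput (q : Option Γ → Code c) :
    stepAux (onPopOutput q) v (allStacks c s t) =
      stepAux (q ((t c.tm.k₁).head?.map c.outputAlphabet)) (none, v.2)
        (allStacks c s (Function.update t c.tm.k₁ (t c.tm.k₁).tail)) := by
  rw [onPopOutput, stepAux_popCase, ← update_allStacks_inr]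
  · rfl
  · intro a b h
    have h' : a.map c.outputAlphabet = b.map c.outputAlphabet := by simpa using h
    exact Option.map_injective c.outputAlphabet.injective h'

@[simp]
theorem stepAux_putInput (a : FormulaSymbol) (q : Code c) :
    stepAux (putInput a q) v (allStacks c s t) =
      stepAux q v (allStacks c s
        (Function.update t c.tm.k₀ (c.inputAlphabet.symm a :: t c.tm.k₀))) := by
  rw [putInput, stepAux, ← update_allStacks_inr]
  rfl

theorem step_config (l : Label) :
    step (code c) (config c l s) =
      some (stepAux (program c l) (none, c.tm.initialState) (allStacks c s fun _ => [])) := rfl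

/-- The simulation is step for step, with no loss of time: a halted configuration of the reduction
is represented by one at the label `ret`. -/
theorem reachesWithin_embed (r b : Bool) {n : ℕ} {d d' : TM2.Cfg c.tm.Γ c.tm.Λ c.tm.σ}
    (h : ReachesWithin (step c.tm.m) n d d') :
    ReachesWithin (step (code c)) n (embedConfig r b s d) (embedConfig r b s d') := by
  obtain ⟨m, hm, e⟩ := h
  refine ReachesWithin.mono ?_ hm
  clear hm
  induction m generalizing d' with
  | zero =>
    obtain rfl : d = d' := Option.some.inj e
    exact .refl _ _
  | succ m ih =>
    rw [Function.iterate_succ_apply'] at e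
    cases he : (flip bind (step c.tm.m))^[m] (some d) with
    | none => rw [he] at e; cases e
    | some d₁ =>
      rw [he] at e
      refine (ih he).tail ?_
      have hd : step c.tm.m d₁ = some d' := e
      obtain ⟨_ | l, x, t⟩ := d₁
      · simp at hd
      · obtain rfl : stepAux (c.tm.m l) x t = d' := by simpa using hd
        exact congrArg some (stepAux_embedStmt s r b _ _ _)

end Step

attribute [simp] Store.get Store.set

/-! ### Loops that move or clear stacks -/

section Loops

open TM2 TM2.Stmt

variable {Γ : Type} [Finite Γ] {c : TM2ComputableAux FormulaSymbol Γ}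

theorem unload_loop : ∀ (l : List FormulaSymbol) (s : Store Γ), s.input = l →
    ReachesWithin (step (code c)) (l.length + 1) (config c .unload s)
      (config c .reload { s with input := [], rev := l.reverse ++ s.rev })
  | [], s, h => .single (by simp [step_config, program, h])
  | a :: l, s, h => by
    refine .head (b := config c .unload { s with input := l, rev := a :: s.rev })
      (by simp [step_config, program, h]) ?_
    simpa using unload_loop l { s with input := l, rev := a :: s.rev } rfl

theorem reload_loop : ∀ (l : List FormulaSymbol) (s : Store Γ), s.rev = l →
    ReachesWithin (step (code c)) (l.length + 1) (config c .reload s)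
      (config c (.scan true none)
        { s with rev := [], input := l.reverse ++ s.input, child := l.reverse ++ s.child })
  | [], s, h => .single (by simp [step_config, program, h])
  | a :: l, s, h => by
    refine .head (b := config c .reload
        { s with rev := l, input := a :: s.input, child := a :: s.child })
      (by simp [step_config, program, h]) ?_
    simpa using reload_loop l { s with rev := l, input := a :: s.input, child := a :: s.child } rfl

theorem flip_loop (r : Bool) : ∀ (l : List Bool) (s : Store Γ), s.nameRev = l →
    ReachesWithin (step (code c)) (l.length + 1) (config c (.flip r) s)
      (config c (.subst r false) { s with nameRev := [], name := l.reverse ++ s.name })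
  | [], s, h => .single (by simp [step_config, program, h])
  | a :: l, s, h => by
    refine .head (b := config c (.flip r) { s with nameRev := l, name := a :: s.name })
      (by simp [step_config, program, h]) ?_
    simpa using flip_loop r l { s with nameRev := l, name := a :: s.name } rfl

theorem unback_loop (r b : Bool) : ∀ (l : List FormulaSymbol) (s : Store Γ)
    (t : ∀ k, List (c.tm.Γ k)), s.back = l →
    ReachesWithin (step (code c)) (l.length + 1)
      ⟨some (.inl (.unback r b)), (none, c.tm.initialState), allStacks c s t⟩
      ⟨some (.inr ((r, b), c.tm.main)), (none, c.tm.initialState),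
        allStacks c { s with back := [], cur := l.reverse ++ s.cur } t⟩
  | [], s, t, h => .single (by simp [code, program, h])
  | a :: l, s, t, h => by
    refine .head (b := ⟨some (.inl (.unback r b)), (none, c.tm.initialState),
      allStacks c { s with back := l, cur := a :: s.cur } t⟩) (by simp [code, program, h, jump]) ?_
    simpa using unback_loop r b l { s with back := l, cur := a :: s.cur } t rfl

theorem load_loop (r b : Bool) : ∀ (l : List FormulaSymbol) (s : Store Γ)
    (i : List (c.tm.Γ c.tm.k₀)), s.rev = l →
    ReachesWithin (step (code c)) (l.length + 1)
      ⟨some (.inl (.load r b)), (none, c.tm.initialState),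
        allStacks c s (Function.update (fun _ => []) c.tm.k₀ i)⟩
      ⟨some (.inl (.unback r b)), (none, c.tm.initialState),
        allStacks c { s with rev := [], child := l.reverse ++ s.child }
          (Function.update (fun _ => []) c.tm.k₀ (l.reverse.map c.inputAlphabet.symm ++ i))⟩
  | [], s, i, h => .single (by simp [code, program, h, jump])
  | a :: l, s, i, h => by
    refine .head (b := ⟨some (.inl (.load r b)), (none, c.tm.initialState),
      allStacks c { s with rev := l, child := a :: s.child }
        (Function.update (fun _ => []) c.tm.k₀ (c.inputAlphabet.symm a :: i))⟩)
      (by simp [code, program, h, jump]) ?_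
    simpa using load_loop r b l { s with rev := l, child := a :: s.child }
      (c.inputAlphabet.symm a :: i) rfl

/-- Popping the output reverses it, which is why `label`, and later the list of known labels, holds
reversals of values of `g`. -/
theorem ret_loop (r b : Bool) : ∀ (l : List Γ) (s : Store Γ),
    ReachesWithin (step (code c)) (l.length + 1)
      ⟨some (.inl (.ret r b)), (none, c.tm.initialState),
        allStacks c s (Function.update (fun _ => []) c.tm.k₁ (l.map c.outputAlphabet.symm))⟩
      (config c (.lookup r b false) { s with label := l.reverse ++ s.label })
  | [], s => .single (by simp [code, program])
  | a :: l, s => by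
    refine .head (b := ⟨some (.inl (.ret r b)), (none, c.tm.initialState),
      allStacks c { s with label := a :: s.label }
        (Function.update (fun _ => []) c.tm.k₁ (l.map c.outputAlphabet.symm))⟩)
      (by simp [code, program, jump]) ?_
    simpa using ret_loop r b l { s with label := a :: s.label }

theorem unlookup_loop (r b f : Bool) : ∀ (l : List (Option Γ)) (s : Store Γ), s.knownRev = l →
    ReachesWithin (step (code c)) (l.length + 1) (config c (.unlookup r b f) s)
      (config c (if f then .drop r b else .wipe .enter)
        { s with knownRev := [], known := l.reverse ++ s.known })
  | [], s, h => .single (by cases f <;> simp [step_config, program, h])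
  | a :: l, s, h => by
    refine .head (b := config c (.unlookup r b f) { s with knownRev := l, known := a :: s.known })
      (by simp [step_config, program, h]) ?_
    simpa using unlookup_loop r b f l { s with knownRev := l, known := a :: s.known } rfl

theorem keepLabel_loop : ∀ (l : List Γ) (s : Store Γ), s.label = l →
    ReachesWithin (step (code c)) (l.length + 1) (config c .keepLabel s)
      (config c (.scan false none) { s with label := [], curLabel := l.reverse ++ s.curLabel })
  | [], s, h => .single (by simp [step_config, program, h])
  | a :: l, s, h => by
    refine .head (b := config c .keepLabel { s with label := l, curLabel := a :: s.curLabel })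
      (by simp [step_config, program, h]) ?_
    simpa using keepLabel_loop l { s with label := l, curLabel := a :: s.curLabel } rfl

theorem record_loop : ∀ (l : List Γ) (s : Store Γ), s.curLabel = l →
    ReachesWithin (step (code c)) (l.length + 1) (config c .record s)
      (config c (.wipe .restart)
        { s with curLabel := [], known := none :: (l.reverse.map some ++ s.known) })
  | [], s, h => .single (by simp [step_config, program, h])
  | a :: l, s, h => by
    refine .head (b := config c .record { s with curLabel := l, known := some a :: s.known })
      (by simp [step_config, program, h]) ?_
    simpa using record_loop l { s with curLabel := l, known := some a :: s.known } rfl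

/-- Both stacks are popped in parallel, and popping an empty stack has no effect, so the longer one
determines the time. The step that leaves the loop is left to the caller. The same holds for
`wipe_loop` and `finish_loop`. -/
theorem drop_loop (r b : Bool) : ∀ (n : ℕ) (s : Store Γ), s.child.length ≤ n →
    s.label.length ≤ n → ReachesWithin (step (code c)) n (config c (.drop r b) s)
      (config c (.drop r b) { s with child := [], label := [] })
  | 0, s, h₁, h₂ => by
    obtain ⟨⟩ := s
    simp_all [ReachesWithin.refl]
  | n + 1, s, h₁, h₂ => by
    by_cases h : s.child = [] ∧ s.label = []
    · obtain ⟨⟩ := s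
      obtain ⟨rfl, rfl⟩ := h
      exact .refl _ _
    · refine .head (b := config c (.drop r b)
        { s with child := s.child.tail, label := s.label.tail }) ?_ ?_
      · simp [step_config, program, h]
      · exact drop_loop r b n { s with child := s.child.tail, label := s.label.tail }
          (by simpa using h₁) (by simpa using h₂)

theorem wipe_loop (t : Target) : ∀ (n : ℕ) (s : Store Γ), s.cur.length ≤ n → s.name.length ≤ n →
    s.values.length ≤ n → s.curLabel.length ≤ n →
    ReachesWithin (step (code c)) n (config c (.wipe t) s)
      (config c (.wipe t) { s with cur := [], name := [], values := [], curLabel := [] })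
  | 0, s, h₁, h₂, h₃, h₄ => by
    obtain ⟨⟩ := s
    simp_all [ReachesWithin.refl]
  | n + 1, s, h₁, h₂, h₃, h₄ => by
    by_cases h : ((s.cur = [] ∧ s.name = []) ∧ s.values = []) ∧ s.curLabel = []
    · obtain ⟨⟩ := s
      obtain ⟨⟨⟨rfl, rfl⟩, rfl⟩, rfl⟩ := h
      exact .refl _ _
    · refine .head (b := config c (.wipe t) { s with
        cur := s.cur.tail, name := s.name.tail,
        values := s.values.tail, curLabel := s.curLabel.tail }) ?_ ?_
      · simp [step_config, program, h]
      · exact wipe_loop t n { s with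
          cur := s.cur.tail, name := s.name.tail,
          values := s.values.tail, curLabel := s.curLabel.tail }
          (by simpa using h₁) (by simpa using h₂) (by simpa using h₃) (by simpa using h₄)

theorem finish_loop (a : Bool) : ∀ (n : ℕ) (s : Store Γ), s.input.length ≤ n →
    s.known.length ≤ n → ReachesWithin (step (code c)) n (config c (.finish a) s)
      (config c (.finish a) { s with input := [], known := [] })
  | 0, s, h₁, h₂ => by
    obtain ⟨⟩ := s
    simp_all [ReachesWithin.refl]
  | n + 1, s, h₁, h₂ => by
    by_cases h : s.input = [] ∧ s.known = []
    · obtain ⟨⟩ := s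
      obtain ⟨rfl, rfl⟩ := h
      exact .refl _ _
    · refine .head (b := config c (.finish a)
        { s with input := s.input.tail, known := s.known.tail }) ?_ ?_
      · simp [step_config, program, h]
      · exact finish_loop a n { s with input := s.input.tail, known := s.known.tail }
          (by simpa using h₁) (by simpa using h₂)

end Loops

/-! ### Passes over a string and over the list of known labels -/

theorem ne_var_of_mem_digits {ds : List Bool} {a : FormulaSymbol}
    (h : a ∈ ds.map FormulaSymbol.digit) : a ≠ .var := by
  obtain ⟨d, _, rfl⟩ := List.mem_map.1 h
  simp

section Passes

open TM2 TM2.Stmt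

variable {Γ : Type} [Finite Γ] {c : TM2ComputableAux FormulaSymbol Γ}

theorem scan_before (r : Bool) (w : List FormulaSymbol) : ∀ (l : List FormulaSymbol) (s : Store Γ),
    (∀ a ∈ l, a ≠ .var) → s.child = l ++ w →
    ReachesWithin (step (code c)) l.length (config c (.scan r none) s)
      (config c (.scan r none) { s with child := w, back := l.reverse ++ s.back })
  | [], s, _, h => by
    obtain ⟨⟩ := s
    simp_all [ReachesWithin.refl]
  | a :: l, s, ha, h => by
    refine .head (b := config c (.scan r none) { s with child := l ++ w, back := a :: s.back })
      ?_ ?_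
    · have := ha a (by simp)
      cases a <;> simp_all [step_config, program]
    · simpa using scan_before r w l { s with child := l ++ w, back := a :: s.back }
        (fun x hx => ha x (by simp [hx])) rfl

theorem scan_inside (r : Bool) (w : List FormulaSymbol) : ∀ (l : List Bool) (s : Store Γ),
    s.child = l.map .digit ++ w →
    ReachesWithin (step (code c)) l.length (config c (.scan r (some true)) s)
      (config c (.scan r (some true)) { s with
        child := w, back := (l.map .digit).reverse ++ s.back, nameRev := l.reverse ++ s.nameRev })
  | [], s, h => by
    obtain ⟨⟩ := s
    simp_all [ReachesWithin.refl]
  | a :: l, s, h => by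
    refine .head (b := config c (.scan r (some true)) { s with
      child := l.map .digit ++ w, back := .digit a :: s.back, nameRev := a :: s.nameRev })
      (by simp [step_config, program, h]) ?_
    simpa using scan_inside r w l { s with
      child := l.map .digit ++ w, back := .digit a :: s.back, nameRev := a :: s.nameRev } rfl

theorem scan_after (r : Bool) : ∀ (l : List FormulaSymbol) (s : Store Γ), s.child = l →
    ReachesWithin (step (code c)) (l.length + 1) (config c (.scan r (some false)) s)
      (config c (.evaluate r false false) { s with child := [], back := l.reverse ++ s.back })
  | [], s, h => .single (by simp [step_config, program, h])
  | a :: l, s, h => by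
    refine .head (b := config c (.scan r (some false)) { s with child := l, back := a :: s.back })
      (by cases a <;> simp [step_config, program, h]) ?_
    simpa using scan_after r l { s with child := l, back := a :: s.back } rfl

/-- The name of the variable ends either at the end of the string or at the next token, whose first
symbol is not a digit by properness and so ends the phase. -/
theorem scan_rest (r : Bool) {ts : List Token} (hp : Proper ts) (s : Store Γ)
    (h : s.child = flat ts) :
    ReachesWithin (step (code c)) ((flat ts).length + 1) (config c (.scan r (some true)) s)
      (config c (.evaluate r false false)
        { s with child := [], back := (flat ts).reverse ++ s.back }) := by
  cases ts with
  | nil => exact .single (by simp [step_config, program, h])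
  | cons t ts =>
    obtain ⟨a, ds⟩ := t
    have ha : ¬ a.IsDigit := hp _ (List.mem_cons_self ..)
    refine .head (b := config c (.scan r (some false))
      { s with child := ds.map .digit ++ flat ts, back := a :: s.back }) ?_ ?_
    · cases a <;> simp_all [step_config, program, FormulaSymbol.IsDigit]
    · simpa using scan_after r _
        { s with child := ds.map .digit ++ flat ts, back := a :: s.back } rfl

theorem scan_tokens (r : Bool) : ∀ (ts : List Token) (_ : Proper ts) (s : Store Γ),
    s.child = flat ts →
    ReachesWithin (step (code c)) ((flat ts).length + 1) (config c (.scan r none) s)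
      (config c (.evaluate r (firstVar ts).isNone (firstVar ts).isNone) { s with
        child := [], back := (flat ts).reverse ++ s.back,
        nameRev := ((firstVar ts).getD []).reverse ++ s.nameRev })
  | [], _, s, h => .single (by simp [step_config, program, h, firstVar])
  | (a, ds) :: ts, hp, s, h => by
    have hp' : Proper ts := fun t ht => hp t (List.mem_cons_of_mem _ ht)
    by_cases ha : a = .var
    · subst ha
      have h₁ := scan_inside (c := c) r (flat ts) ds { s with
        child := ds.map .digit ++ flat ts, back := .var :: s.back } rfl
      have h₂ := h₁.trans (scan_rest r hp' _ rfl)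
      have h₃ := ReachesWithin.head (a := config c (.scan r none) s)
        (by simp [step_config, program, h]) h₂
      simp only [firstVar, if_true]
      exact h₃.congr (by simp) (by simp; omega)
    · have h₁ := scan_before (c := c) r (flat ts) (a :: ds.map .digit) s
        (List.forall_mem_cons.2 ⟨ha, fun _ => ne_var_of_mem_digits⟩) (by simpa using h)
      have h₂ := h₁.trans (scan_tokens r ts hp' _ rfl)
      simp only [firstVar, if_neg ha]
      exact h₂.congr (by simp) (by simp; omega)

theorem scan_string (r : Bool) (w : List FormulaSymbol) (s : Store Γ) (h : s.child = w) :
    ReachesWithin (step (code c)) (w.length + 1) (config c (.scan r none) s)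
      (config c (.evaluate r (firstVar (tokenize w).2).isNone (firstVar (tokenize w).2).isNone)
        { s with
          child := [], back := w.reverse ++ s.back,
          nameRev := ((firstVar (tokenize w).2).getD []).reverse ++ s.nameRev }) := by
  have e := spell_tokenize w
  have hp := proper_tokenize w
  generalize tokenize w = p at e hp ⊢
  obtain ⟨ds, ts⟩ := p
  subst e
  have h₁ := scan_before (c := c) r (flat ts) (ds.map .digit) s
    (fun _ => ne_var_of_mem_digits) (by simpa [spell] using h)
  have h₂ := h₁.trans (scan_tokens r ts hp _ rfl)
  exact h₂.congr (by simp [spell]) (by simp [spell]; omega)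

theorem evaluate_stopped (r cl : Bool) : ∀ (l : List FormulaSymbol) (s : Store Γ), s.back = l →
    ReachesWithin (step (code c)) l.length (config c (.evaluate r cl false) s)
      (config c (.evaluate r cl false) { s with back := [], cur := l.reverse ++ s.cur })
  | [], s, h => by
    obtain ⟨⟩ := s
    simp_all [ReachesWithin.refl]
  | a :: l, s, h => by
    refine .head (b := config c (.evaluate r cl false) { s with back := l, cur := a :: s.cur })
      (by cases a <;> simp [step_config, program, h]) ?_
    simpa using evaluate_stopped r cl l { s with back := l, cur := a :: s.cur } rfl

theorem foldl_pushValue_none (l : List FormulaSymbol) :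
    l.foldl (fun o a => pushValue a o) none = none := by
  rw [← List.foldr_reverse, foldr_pushValue_none]

/-- After a failure the remaining stack of values is irrelevant, since it is wiped later; only its
length matters, for the cost of the wiping. -/
theorem evaluate_step (r cl : Bool) {a : FormulaSymbol} {l : List FormulaSymbol} (s : Store Γ)
    (h : s.back = a :: l) : ∃ ok vs, step (code c) (config c (.evaluate r cl true) s) =
        some (config c (.evaluate r cl ok) { s with back := l, cur := a :: s.cur, values := vs }) ∧
      pushValue a (some s.values) = (if ok then some vs else none) ∧
      vs.length ≤ s.values.length + 1 := by
  obtain ⟨_, _, _, _, _, _, _, _, v, _, _, _, _, _⟩ := s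
  cases a with
  | const b => exact ⟨true, b :: v, by simp_all [step_config, program], rfl, by simp⟩
  | var => exact ⟨false, v, by simp_all [step_config, program], rfl, by simp⟩
  | digit d => exact ⟨false, v, by simp_all [step_config, program], rfl, by simp⟩
  | neg =>
    match v with
    | [] => exact ⟨false, [], by simp_all [step_config, program], rfl, by simp⟩
    | x :: v => exact ⟨true, (!x) :: v, by simp_all [step_config, program], rfl, by simp⟩
  | conj =>
    match v with
    | [] => exact ⟨false, [], by simp_all [step_config, program], rfl, by simp⟩
    | [x] => exact ⟨false, [], by simp_all [step_config, program], rfl, by simp⟩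
    | x :: y :: v =>
      exact ⟨true, (x && y) :: v, by simp_all [step_config, program], rfl, by simp⟩
  | disj =>
    match v with
    | [] => exact ⟨false, [], by simp_all [step_config, program], rfl, by simp⟩
    | [x] => exact ⟨false, [], by simp_all [step_config, program], rfl, by simp⟩
    | x :: y :: v =>
      exact ⟨true, (x || y) :: v, by simp_all [step_config, program], rfl, by simp⟩

theorem evaluate_loop (r cl : Bool) : ∀ (l : List FormulaSymbol) (s : Store Γ), s.back = l →
    ∃ ok vs, ReachesWithin (step (code c)) l.length (config c (.evaluate r cl true) s)
        (config c (.evaluate r cl ok)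
          { s with back := [], cur := l.reverse ++ s.cur, values := vs }) ∧
      l.foldl (fun o a => pushValue a o) (some s.values) = (if ok then some vs else none) ∧
      vs.length ≤ s.values.length + l.length
  | [], s, h => by
    obtain ⟨⟩ := s
    exact ⟨true, _, by simp_all [ReachesWithin.refl], rfl, by simp⟩
  | a :: l, s, h => by
    obtain ⟨ok, vs, h₁, h₂, h₃⟩ := evaluate_step (c := c) r cl s h
    cases ok with
    | false =>
      refine ⟨false, vs, ?_, ?_, by simp; omega⟩
      · simpa using ReachesWithin.head h₁ (evaluate_stopped r cl l
          { s with back := l, cur := a :: s.cur, values := vs } rfl)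
      · rw [List.foldl_cons, h₂]
        exact foldl_pushValue_none l
    | true =>
      obtain ⟨ok', vs', g₁, g₂, g₃⟩ := evaluate_loop r cl l
        { s with back := l, cur := a :: s.cur, values := vs } rfl
      refine ⟨ok', vs', ?_, ?_, by simp at g₃ ⊢; omega⟩
      · simpa using ReachesWithin.head h₁ g₁
      · rw [List.foldl_cons, h₂]
        exact g₂

theorem subst_plain (r b : Bool) (w : List FormulaSymbol) : ∀ (l : List FormulaSymbol)
    (s : Store Γ), (∀ a ∈ l, a ≠ .var) → s.cur = l ++ w →
    ReachesWithin (step (code c)) l.length (config c (.subst r b) s)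
      (config c (.subst r b)
        { s with cur := w, back := l.reverse ++ s.back, rev := l.reverse ++ s.rev })
  | [], s, _, h => by
    obtain ⟨⟩ := s
    simp_all [ReachesWithin.refl]
  | a :: l, s, ha, h => by
    refine .head (b := config c (.subst r b)
      { s with cur := l ++ w, back := a :: s.back, rev := a :: s.rev }) ?_ ?_
    · have := ha a (by simp)
      simp [step_config, program, h, this]
    · simpa using subst_plain r b w l
        { s with cur := l ++ w, back := a :: s.back, rev := a :: s.rev }
        (fun x hx => ha x (by simp [hx])) rfl

/-- The hypothesis on `w` makes `ds` the complete name, so the loop stops right after it. If the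
stored name runs out early the flag becomes false at once; if digits of it remain, the final look at
`name` makes it false. -/
theorem compare_loop (r b : Bool) (w : List FormulaSymbol)
    (hw : ∀ d, w.head? ≠ some (.digit d)) : ∀ (ds : List Bool) (m : Bool) (s : Store Γ),
    s.cur = ds.map .digit ++ w →
    ReachesWithin (step (code c)) (ds.length + 1) (config c (.compare r b m) s)
      (config c (.restore r b (m && decide (ds = s.name))) { s with
        cur := w
        back := (ds.map .digit).reverse ++ s.back
        rev := (ds.map .digit).reverse ++ s.rev
        name := s.name.drop ds.length
        nameRev := (s.name.take ds.length).reverse ++ s.nameRev })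
  | [], m, s, h => .single (by
    obtain ⟨_, _, cur, _, _, _, name, _, _, _, _, _, _, _⟩ := s
    obtain rfl : cur = w := by simpa using h
    rcases cur with _ | ⟨(_ | _ | d | _ | _ | _), cur⟩
    rotate_left 3
    · exact absurd rfl (hw d)
    all_goals cases name <;> simp [step_config, program])
  | d :: ds, m, s, h => by
    obtain ⟨i, o, cur, ch, rev, back, name, nameRev, v, l₁, l₂, l₃, k₁, k₂⟩ := s
    obtain rfl : cur = (d :: ds).map .digit ++ w := h
    cases name with
    | nil =>
      exact (ReachesWithin.head (by simp [step_config, program]) (compare_loop r b w hw ds false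
        ⟨i, o, ds.map .digit ++ w, ch, .digit d :: rev, .digit d :: back, [], nameRev,
          v, l₁, l₂, l₃, k₁, k₂⟩ rfl)).congr (by simp) le_rfl
    | cons e name =>
      exact (ReachesWithin.head (by simp [step_config, program])
        (compare_loop r b w hw ds (m && d == e)
        ⟨i, o, ds.map .digit ++ w, ch, .digit d :: rev, .digit d :: back, name, e :: nameRev,
          v, l₁, l₂, l₃, k₁, k₂⟩ rfl)).congr
        (by simp [Bool.and_assoc, Bool.beq_eq_decide_eq]) le_rfl

theorem restore_loop (r b : Bool) : ∀ (l : List Bool) (s : Store Γ), s.nameRev = l →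
    ReachesWithin (step (code c)) (l.length + 1) (config c (.restore r b false) s)
      (config c (.subst r b) { s with nameRev := [], name := l.reverse ++ s.name })
  | [], s, h => .single (by simp [step_config, program, h])
  | a :: l, s, h => by
    refine .head (b := config c (.restore r b false) { s with nameRev := l, name := a :: s.name })
      (by simp [step_config, program, h]) ?_
    simpa using restore_loop r b l { s with nameRev := l, name := a :: s.name } rfl

/-- After a match the name is as long as the run `u` of digits on `rev`, so popping both together
uncovers exactly the letter `x` that opened the variable. -/
theorem restore_replace_loop (r b : Bool) (x : FormulaSymbol) (w : List FormulaSymbol) :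
    ∀ (l : List Bool) (u : List FormulaSymbol) (s : Store Γ), s.nameRev = l →
    s.rev = u ++ x :: w → u.length = l.length →
    ReachesWithin (step (code c)) (l.length + 1) (config c (.restore r b true) s)
      (config c (.subst r b)
        { s with nameRev := [], name := l.reverse ++ s.name, rev := .const b :: w })
  | [], u, s, h, h', hu => .single (by
    obtain rfl : u = [] := List.length_eq_zero_iff.1 hu
    simp [step_config, program, h, h'])
  | a :: l, [], s, h, h', hu => by simp at hu
  | a :: l, y :: u, s, h, h', hu => by
    refine .head (b := config c (.restore r b true)
        { s with nameRev := l, name := a :: s.name, rev := u ++ x :: w })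
      (by simp [step_config, program, h, h']) ?_
    simpa using restore_replace_loop r b x w l u
      { s with nameRev := l, name := a :: s.name, rev := u ++ x :: w } rfl rfl (by simpa using hu)

theorem head_flat_ne_digit {ts : List Token} (hp : Proper ts) (d : Bool) :
    (flat ts).head? ≠ some (.digit d) := by
  cases ts with
  | nil => simp
  | cons t ts =>
    intro h
    exact hp t (List.mem_cons_self ..) ⟨d, by simpa using h⟩

theorem subst_var (r b : Bool) (ds : List Bool) {ts : List Token} (hp : Proper ts) (s : Store Γ)
    (h : s.cur = .var :: (ds.map .digit ++ flat ts)) (hn : s.nameRev = []) :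
    ReachesWithin (step (code c)) (ds.length + s.name.length + 3) (config c (.subst r b) s)
      (config c (.subst r b) { s with
        cur := flat ts
        back := (flat [(.var, ds)]).reverse ++ s.back
        rev := (flat [Token.subst s.name b (.var, ds)]).reverse ++ s.rev }) := by
  obtain ⟨i, o, cur, ch, rev, back, name, nameRev, v, l₁, l₂, l₃, k₁, k₂⟩ := s
  obtain rfl : nameRev = [] := hn
  obtain rfl : cur = _ := h
  have h₁ := ReachesWithin.head
    (a := config c (.subst r b) ⟨i, o, .var :: (ds.map .digit ++ flat ts), ch, rev, back, name, [],
      v, l₁, l₂, l₃, k₁, k₂⟩) (by simp [step_config, program])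
    (compare_loop r b (flat ts) (head_flat_ne_digit hp) ds true
    ⟨i, o, ds.map .digit ++ flat ts, ch, .var :: rev, .var :: back, name, [],
      v, l₁, l₂, l₃, k₁, k₂⟩ rfl)
  by_cases e : ds = name
  · subst e
    have h₂ := restore_replace_loop (c := c) r b .var rev ds.reverse (ds.map .digit).reverse
      ⟨i, o, flat ts, ch, (ds.map .digit).reverse ++ .var :: rev,
        (ds.map .digit).reverse ++ .var :: back, [], ds.reverse,
        v, l₁, l₂, l₃, k₁, k₂⟩ rfl rfl (by simp)
    have h₁' := h₁.congr (b' := config c (.restore r b true)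
      ⟨i, o, flat ts, ch, (ds.map .digit).reverse ++ .var :: rev,
        (ds.map .digit).reverse ++ .var :: back, [], ds.reverse,
        v, l₁, l₂, l₃, k₁, k₂⟩) (by simp) le_rfl
    exact (h₁'.trans h₂).congr (by simp [Token.subst]) (by simp; omega)
  · have h₂ := restore_loop (c := c) r b (name.take ds.length).reverse
      ⟨i, o, flat ts, ch, (ds.map .digit).reverse ++ .var :: rev,
        (ds.map .digit).reverse ++ .var :: back, name.drop ds.length,
        (name.take ds.length).reverse, v, l₁, l₂, l₃, k₁, k₂⟩ rfl
    have h₁' := h₁.congr (b' := config c (.restore r b false)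
      ⟨i, o, flat ts, ch, (ds.map .digit).reverse ++ .var :: rev,
        (ds.map .digit).reverse ++ .var :: back, name.drop ds.length,
        (name.take ds.length).reverse, v, l₁, l₂, l₃, k₁, k₂⟩) (by simp [e]) le_rfl
    exact (h₁'.trans h₂).congr (by simp [Token.subst, e]) (by simp; omega)

/-- Treating a token costs at most its number of digits plus `s.name.length + 3`. As a token has at
least one symbol, this is at most `s.name.length + 3` per symbol. -/
theorem subst_tokens (r b : Bool) : ∀ (ts : List Token) (_ : Proper ts) (s : Store Γ),
    s.cur = flat ts → s.nameRev = [] →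
    ReachesWithin (step (code c)) ((flat ts).length * (s.name.length + 3) + 1)
      (config c (.subst r b) s)
      (config c (.load r b) { s with
        cur := []
        back := (flat ts).reverse ++ s.back
        rev := (flat (ts.map (Token.subst s.name b))).reverse ++ s.rev })
  | [], _, s, h, hn => (ReachesWithin.single (by simp [step_config, program, h])).mono (by simp)
  | (a, ds) :: ts, hp, s, h, hn => by
    have hp' : Proper ts := fun t ht => hp t (List.mem_cons_of_mem _ ht)
    have key : ReachesWithin (step (code c)) (ds.length + s.name.length + 3)
        (config c (.subst r b) s) (config c (.subst r b) { s with
        cur := flat ts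
        back := (flat [(a, ds)]).reverse ++ s.back
        rev := (flat [Token.subst s.name b (a, ds)]).reverse ++ s.rev }) := by
      by_cases ha : a = .var
      · subst ha
        exact subst_var r b ds hp' s (by simpa using h) hn
      · exact (subst_plain (c := c) r b (flat ts) (a :: ds.map .digit) s
          (List.forall_mem_cons.2 ⟨ha, fun _ => ne_var_of_mem_digits⟩) (by simpa using h)).congr
          (by simp [Token.subst, ha]) (by simp; omega)
    refine (key.trans (subst_tokens r b ts hp' _ rfl hn)).congr (by simp) ?_
    simp only [flat_cons, List.length_cons, List.length_append, List.length_map]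
    nlinarith [Nat.zero_le (ds.length * s.name.length), Nat.zero_le ds.length]

theorem subst_string (r b : Bool) (w : List FormulaSymbol) (s : Store Γ) (h : s.cur = w)
    (hn : s.nameRev = []) :
    ReachesWithin (step (code c)) (w.length * (s.name.length + 3) + 1) (config c (.subst r b) s)
      (config c (.load r b) { s with
        cur := [], back := w.reverse ++ s.back,
        rev := (substString s.name b w).reverse ++ s.rev }) := by
  unfold substString
  have e := spell_tokenize w
  have hp := proper_tokenize w
  generalize tokenize w = p at e hp ⊢
  obtain ⟨ds, ts⟩ := p
  subst e
  have h₁ := subst_plain (c := c) r b (flat ts) (ds.map .digit) s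
    (fun _ => ne_var_of_mem_digits) (by simpa [spell] using h)
  have h₂ := h₁.trans (subst_tokens r b ts hp _ rfl hn)
  refine h₂.congr (by simp [spell]) ?_
  simp only [spell, List.length_append, List.length_map]
  nlinarith [Nat.zero_le (ds.length * s.name.length), Nat.zero_le ds.length]

/-- The list of the known labels, as it is written on the stack `known`. -/
def encodeKnown (us : List (List Γ)) : List (Option Γ) :=
  us.flatMap fun y => none :: y.map some

theorem lookupCompare_loop (r b f : Bool) (w : List (Option Γ))
    (hw : ∀ a, w.head? ≠ some (some a)) : ∀ (y : List Γ) (m : Bool) (s : Store Γ),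
    s.known = y.map some ++ w →
    ReachesWithin (step (code c)) (y.length + 1) (config c (.lookupCompare r b f m) s)
      (config c (.lookupRestore r b f (m && open Classical in decide (y = s.label))) { s with
        known := w
        knownRev := (y.map some).reverse ++ s.knownRev
        label := s.label.drop y.length
        labelRev := (s.label.take y.length).reverse ++ s.labelRev })
  | [], m, s, h => .single (by
    obtain ⟨_, _, _, _, _, _, _, _, _, label, _, _, known, _⟩ := s
    obtain rfl : known = w := by simpa using h
    rcases known with _ | ⟨_ | a, known⟩
    rotate_left 2
    · exact absurd rfl (hw a)
    all_goals cases label <;> simp [step_config, program])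
  | a :: y, m, s, h => by
    classical
    obtain ⟨i, o, cur, ch, rev, back, name, nameRev, v, l₁, l₂, l₃, k₁, k₂⟩ := s
    obtain rfl : k₁ = (a :: y).map some ++ w := h
    cases l₁ with
    | nil =>
      exact (ReachesWithin.head (by simp [step_config, program])
        (lookupCompare_loop r b f w hw y false ⟨i, o, cur, ch, rev, back, name, nameRev, v,
          [], l₂, l₃, y.map some ++ w, some a :: k₂⟩ rfl)).congr (by simp) le_rfl
    | cons e l₁ =>
      exact (ReachesWithin.head (by simp [step_config, program])
        (lookupCompare_loop r b f w hw y (m && decide (a = e))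
        ⟨i, o, cur, ch, rev, back, name, nameRev, v,
          l₁, e :: l₂, l₃, y.map some ++ w, some a :: k₂⟩ rfl)).congr
        (by simp [Bool.and_assoc]) le_rfl

theorem lookupRestore_loop (r b f m : Bool) : ∀ (l : List Γ) (s : Store Γ), s.labelRev = l →
    ReachesWithin (step (code c)) (l.length + 1) (config c (.lookupRestore r b f m) s)
      (config c (.lookup r b (f || m)) { s with labelRev := [], label := l.reverse ++ s.label })
  | [], s, h => .single (by simp [step_config, program, h])
  | a :: l, s, h => by
    refine .head (b := config c (.lookupRestore r b f m)
      { s with labelRev := l, label := a :: s.label }) (by simp [step_config, program, h]) ?_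
    simpa using lookupRestore_loop r b f m l { s with labelRev := l, label := a :: s.label } rfl

/-- Each entry opens with the marker `none`, which stops the comparison with the entry before it.
The child's label is restored after each comparison, and the time is again charged to the symbols of
the list. -/
theorem lookup_loop (r b : Bool) : ∀ (us : List (List Γ)) (f : Bool) (s : Store Γ),
    s.known = encodeKnown us → s.labelRev = [] →
    ReachesWithin (step (code c)) ((encodeKnown us).length * (s.label.length + 3) + 1)
      (config c (.lookup r b f) s)
      (config c (.unlookup r b (f || open Classical in decide (s.label ∈ us)))
        { s with known := [], knownRev := (encodeKnown us).reverse ++ s.knownRev })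
  | [], f, s, h, hl =>
    (ReachesWithin.single (by simp [step_config, program, h, encodeKnown])).mono (by simp)
  | y :: us, f, s, h, hl => by
    classical
    obtain ⟨i, o, cur, ch, rev, back, name, nameRev, v, l₁, l₂, l₃, k₁, k₂⟩ := s
    obtain rfl : l₂ = [] := hl
    obtain rfl : k₁ = none :: (y.map some ++ encodeKnown us) := h
    have hw : ∀ a, (encodeKnown us).head? ≠ some (some a) := by
      cases us <;> simp [encodeKnown]
    have h₁ := lookupCompare_loop (c := c) r b f (encodeKnown us) hw y true
      ⟨i, o, cur, ch, rev, back, name, nameRev, v, l₁, [], l₃,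
        y.map some ++ encodeKnown us, none :: k₂⟩ rfl
    have h₂ := h₁.trans (lookupRestore_loop r b f _ _ _ rfl)
    have h₃ := h₂.trans (lookup_loop r b us _ _ rfl rfl)
    have h₄ := ReachesWithin.head (a := config c (.lookup r b f)
      ⟨i, o, cur, ch, rev, back, name, nameRev, v, l₁, [], l₃,
        none :: (y.map some ++ encodeKnown us), k₂⟩) (by simp [step_config, program]) h₃
    have e : encodeKnown (y :: us) = none :: (y.map some ++ encodeKnown us) := rfl
    refine h₄.congr ?_ ?_
    · simp [e, Bool.or_assoc, eq_comm (a := l₁)]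
    · simp only [e, List.length_cons, List.length_append, List.length_map, List.length_reverse,
        List.append_nil, List.reverse_reverse, List.take_append_drop]
      have : (l₁.take y.length).length ≤ l₁.length := by simp
      nlinarith [Nat.zero_le (y.length * l₁.length), Nat.zero_le y.length]

end Passes

/-! ### The phases of a descent -/

section Search

open TM2 TM2.Stmt

variable {Γ : Type} [Finite Γ] {c : TM2ComputableAux FormulaSymbol Γ}

/-- The store at the start of a descent from `ψ`, with input `w`, label `L` of `ψ` and known labels
`us`. -/
def startStore (w ψ : List FormulaSymbol) (L : List Γ) (us : List (List Γ)) : Store Γ :=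
  { input := w, child := ψ, curLabel := L, known := encodeKnown us }

/-- The store at a string `ψ` with first variable `x`. -/
def nodeStore (w ψ : List FormulaSymbol) (x vs : List Bool) (L : List Γ) (us : List (List Γ)) :
    Store Γ :=
  { input := w, cur := ψ, name := x, values := vs, curLabel := L, known := encodeKnown us }

variable (c) in
/-- The configuration of the decision machine that has halted with an answer. -/
def haltConfig (a : Bool) : Config c :=
  ⟨none, (none, c.tm.initialState), allStacks c { output := [a] } fun _ => []⟩

/-- The halting convention demands that the reduction end in its initial internal state with all
stacks but the output empty. Once the output has been popped, the subroutine is ready for another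
call. -/
theorem reaches_call {g : List FormulaSymbol → List Γ} {χ : List FormulaSymbol} {n : ℕ}
    (hM : TM2OutputsInTime c.tm (χ.map c.inputAlphabet.invFun)
      (some ((g χ).map c.outputAlphabet.invFun)) n) (r b : Bool) (s : Store Γ) :
    ReachesWithin (step (code c)) n
      ⟨some (.inr ((r, b), c.tm.main)), (none, c.tm.initialState),
        allStacks c s (Function.update (fun _ => []) c.tm.k₀ (χ.map c.inputAlphabet.symm))⟩
      ⟨some (.inl (.ret r b)), (none, c.tm.initialState),
        allStacks c s (Function.update (fun _ => []) c.tm.k₁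
          ((g χ).map c.outputAlphabet.symm))⟩ := by
  have h : ReachesWithin (step c.tm.m) n (initList c.tm (χ.map c.inputAlphabet.invFun))
      (haltList c.tm ((g χ).map c.outputAlphabet.invFun)) :=
    ⟨hM.steps, hM.steps_le_m, hM.evals_in_steps⟩
  rw [initList_eq, haltList_eq] at h
  exact reachesWithin_embed s r b h

-- One query: form the child, compute its label and search for it in the list. The string `ψ` is
-- rebuilt on the way, so that the other child can still be formed.
open scoped Classical in
theorem reaches_lookup {g : List FormulaSymbol → List Γ} {w ψ : List FormulaSymbol} {x : List Bool}
    {b : Bool} {n N : ℕ} (hM : TM2OutputsInTime c.tm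
      ((substString x b ψ).map c.inputAlphabet.invFun)
      (some ((g (substString x b ψ)).map c.outputAlphabet.invFun)) n)
    (L : List Γ) (us : List (List Γ)) (r : Bool) (hψ : ψ.length ≤ N) (hx : x.length ≤ N)
    (hn : n ≤ N) (hg : (g (substString x b ψ)).length ≤ N) (hk : (encodeKnown us).length ≤ N) :
    ReachesWithin (step (code c)) (12 * (N + 1) ^ 2)
      (config c (.subst r b) (nodeStore w ψ x [] L us))
      (config c (if (g (substString x b ψ)).reverse ∈ us then .drop r b else .wipe .enter)
        { nodeStore w ψ x [] L us with
          child := substString x b ψ, label := (g (substString x b ψ)).reverse }) := by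
  have hχ := length_substString_le x b ψ
  have h₁ := subst_string (c := c) r b ψ (nodeStore w ψ x [] L us) rfl rfl
  generalize hs : substString x b ψ = χ at *
  have hs' : substString (nodeStore w ψ x [] L us).name b ψ = χ := hs
  rw [hs'] at h₁
  have h₂ := load_loop (c := c) r b χ.reverse { nodeStore w ψ x [] L us with
    cur := [], back := ψ.reverse, rev := χ.reverse } [] rfl
  have h₃ := unback_loop (c := c) r b ψ.reverse { nodeStore w ψ x [] L us with
    cur := [], back := ψ.reverse, child := χ }
    (Function.update (fun _ => []) c.tm.k₀ (χ.map c.inputAlphabet.symm)) rfl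
  have h₄ := reaches_call hM r b { nodeStore w ψ x [] L us with child := χ }
  have h₅ := ret_loop (c := c) r b (g χ) { nodeStore w ψ x [] L us with child := χ }
  have h₆ := lookup_loop (c := c) r b us false { nodeStore w ψ x [] L us with
    child := χ, label := (g χ).reverse } rfl rfl
  have h₇ := unlookup_loop (c := c) r b (decide ((g χ).reverse ∈ us)) (encodeKnown us).reverse
    { nodeStore w ψ x [] L us with
    child := χ, label := (g χ).reverse, known := [], knownRev := (encodeKnown us).reverse } rfl
  have h₁₂ := ReachesWithin.trans (h₁.congr (by simp [nodeStore, config]) le_rfl) h₂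
  have h₁₃ := ReachesWithin.trans (h₁₂.congr (by simp [nodeStore]) le_rfl) h₃
  have h₁₄ := ReachesWithin.trans (h₁₃.congr (by simp [nodeStore]) le_rfl) h₄
  have h₁₅ := h₁₄.trans h₅
  have h₁₆ := ReachesWithin.trans (h₁₅.congr (by simp [nodeStore]) le_rfl) h₆
  have h₁₇ := ReachesWithin.trans (h₁₆.congr (by simp [nodeStore]) le_rfl) h₇
  refine h₁₇.congr (by simp [nodeStore]) ?_
  simp only [nodeStore, List.length_reverse]
  -- Only the substitution and the search of the list take quadratic time; the other passes are
  -- linear.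
  have e₁ : ψ.length * (x.length + 3) ≤ N * (N + 3) := by gcongr
  have e₂ : (encodeKnown us).length * ((g χ).length + 3) ≤ N * (N + 3) := by gcongr
  nlinarith

theorem reaches_enter {N : ℕ} (w ψ χ : List FormulaSymbol) (x : List Bool) (L y : List Γ)
    (us : List (List Γ)) (hψ : ψ.length ≤ N) (hx : x.length ≤ N) (hL : L.length ≤ N)
    (hy : y.length ≤ N) :
    ReachesWithin (step (code c)) (2 * N + 2)
      (config c (.wipe .enter) { nodeStore w ψ x [] L us with child := χ, label := y })
      (config c (.scan false none) (startStore w χ y.reverse us)) := by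
  have h₁ := wipe_loop (c := c) .enter N { nodeStore w ψ x [] L us with child := χ, label := y }
    hψ hx (Nat.zero_le _) hL
  have h₂ := h₁.tail (c := config c .keepLabel
    { input := w, child := χ, label := y, known := encodeKnown us })
    (by simp [step_config, program, nodeStore])
  have h₃ := h₂.trans (keepLabel_loop (c := c) y _ rfl)
  exact h₃.congr (by simp [startStore]) (by omega)

theorem reaches_drop {N : ℕ} (w ψ χ : List FormulaSymbol) (x : List Bool) (L y : List Γ)
    (us : List (List Γ)) (r b : Bool) (hχ : χ.length ≤ N) (hy : y.length ≤ N) :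
    ReachesWithin (step (code c)) (N + 1)
      (config c (.drop r b) { nodeStore w ψ x [] L us with child := χ, label := y })
      (config c (if b then (if r then .wipe (.reply false) else .record) else .subst r true)
        (nodeStore w ψ x [] L us)) := by
  have h₁ := drop_loop (c := c) r b N { nodeStore w ψ x [] L us with child := χ, label := y }
    hχ hy
  refine h₁.tail ?_
  cases b <;> cases r <;> simp [step_config, program, nodeStore, giveUp]

theorem reaches_reply {N : ℕ} (w ψ : List FormulaSymbol) (x vs : List Bool) (L : List Γ)
    (us : List (List Γ)) (a : Bool) (hw : w.length ≤ N) (hψ : ψ.length ≤ N) (hx : x.length ≤ N)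
    (hv : vs.length ≤ N) (hL : L.length ≤ N) (hk : (encodeKnown us).length ≤ N) :
    ReachesWithin (step (code c)) (2 * N + 2)
      (config c (.wipe (.reply a)) (nodeStore w ψ x vs L us)) (haltConfig c a) := by
  have h₁ := wipe_loop (c := c) (.reply a) N (nodeStore w ψ x vs L us) hψ hx hv hL
  have h₂ := h₁.tail (c := config c (.finish a) { input := w, known := encodeKnown us })
    (by simp [step_config, program, nodeStore])
  have h₃ := h₂.trans (finish_loop (c := c) a N _ hw hk)
  have h₄ := h₃.tail (c := haltConfig c a) (by simp [step_config, program, haltConfig])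
  exact h₄.mono (by omega)

/-- `curLabel` holds the label in its original order, so recording it symbol by symbol reverses it,
which is the form that lookups compare with. -/
theorem reaches_restart {N : ℕ} (w ψ : List FormulaSymbol) (x vs : List Bool) (L : List Γ)
    (us : List (List Γ)) (hw : w.length ≤ N) (hψ : ψ.length ≤ N) (hx : x.length ≤ N)
    (hv : vs.length ≤ N) (hL : L.length ≤ N) :
    ReachesWithin (step (code c)) (4 * N + 4)
      (config c .record (nodeStore w ψ x vs L us))
      (config c (.scan true none) (startStore w w [] (L.reverse :: us))) := by
  have h₁ := record_loop (c := c) L (nodeStore w ψ x vs L us) rfl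
  have h₂ := h₁.trans (wipe_loop (c := c) .restart N _ hψ hx hv (Nat.zero_le _))
  have h₃ := h₂.tail (c := config c .unload { input := w, known := encodeKnown (L.reverse :: us) })
    (by simp [step_config, program, nodeStore, encodeKnown])
  have h₄ := h₃.trans (unload_loop (c := c) w _ rfl)
  have h₅ := h₄.trans (reload_loop (c := c) _ _ rfl)
  exact h₅.congr (by simp [startStore]) (by simp; omega)

theorem length_le_of_firstVar {ψ : List FormulaSymbol} {x : List Bool}
    (h : firstVar (tokenize ψ).2 = some x) : x.length ≤ ψ.length := by
  have key : ∀ ts : List Token, firstVar ts = some x → x.length ≤ (flat ts).length := by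
    intro ts
    induction ts with
    | nil => simp [firstVar]
    | cons t ts ih =>
      obtain ⟨a, ds⟩ := t
      intro h
      by_cases ha : a = .var
      · obtain rfl : ds = x := by simpa [firstVar, ha] using h
        simp; omega
      · have := ih (by simpa [firstVar, ha] using h)
        simp; omega
  have := key _ h
  conv_rhs => rw [← spell_tokenize ψ]
  simp [spell]; omega

theorem reaches_node {N : ℕ} (w ψ : List FormulaSymbol) (L : List Γ) (us : List (List Γ)) (r : Bool)
    {x : List Bool} (h : firstVar (tokenize ψ).2 = some x) (hψ : ψ.length ≤ N) :
    ReachesWithin (step (code c)) (3 * N + 3)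
      (config c (.scan r none) (startStore w ψ L us))
      (config c (.subst r false) (nodeStore w ψ x [] L us)) := by
  have hx := length_le_of_firstVar h
  have h₁ := scan_string (c := c) r ψ (startStore w ψ L us) rfl
  rw [h] at h₁
  have h₂ := h₁.trans (evaluate_stopped r false _ _ rfl)
  have h₃ := h₂.tail (c := config c (.flip r)
    { input := w, cur := ψ, nameRev := x.reverse, curLabel := L, known := encodeKnown us })
    (by simp [step_config, program, startStore])
  have h₄ := h₃.trans (flip_loop (c := c) r x.reverse _ rfl)
  exact h₄.congr (by simp [nodeStore]) (by simp [startStore]; omega)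

/-- Acceptance requires the stack to be exactly `[true]`: a longer stack comes from several formulas
in a row, and a failed evaluation from a malformed string. -/
theorem reaches_leaf {N : ℕ} (w ψ : List FormulaSymbol) (L : List Γ) (us : List (List Γ)) (r : Bool)
    (h : firstVar (tokenize ψ).2 = none) (hψ : ψ.length ≤ N) :
    (ψ ∈ SAT ∧ ReachesWithin (step (code c)) (2 * N + 2)
      (config c (.scan r none) (startStore w ψ L us))
      (config c (.wipe (.reply true)) (nodeStore w ψ [] [] L us))) ∨
    (ψ ∉ SAT ∧ ∃ vs : List Bool, vs.length ≤ N ∧ ReachesWithin (step (code c)) (2 * N + 2)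
      (config c (.scan r none) (startStore w ψ L us))
      (config c (if r then .wipe (.reply false) else .record) (nodeStore w ψ [] vs L us))) := by
  have h₁ := scan_string (c := c) r ψ (startStore w ψ L us) rfl
  rw [h] at h₁
  obtain ⟨ok, vs, h₂, hvs, hlen⟩ := evaluate_loop (c := c) r true ψ.reverse
    { input := w, back := ψ.reverse, curLabel := L, known := encodeKnown us } rfl
  have h₃ := ReachesWithin.trans (h₁.congr (by simp [startStore]) le_rfl) h₂
  have hlen' : vs.length ≤ N := by simp at hlen; omega
  have ht : ψ.length + 1 + ψ.reverse.length + 1 ≤ 2 * N + 2 := by simp; omega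
  rw [mem_SAT_iff_evalClosed h]
  rw [List.foldl_reverse] at hvs
  have hvs' : evalClosed ψ = if ok = true then some vs else none := hvs
  rw [hvs']
  match ok, vs, h₃, hlen' with
  | true, [true], h₃, _ =>
    exact .inl ⟨rfl, (h₃.tail (by simp [step_config, program, nodeStore])).mono ht⟩
  | true, [], h₃, _ =>
    refine .inr ⟨by simp, [], by simp, (h₃.tail ?_).mono ht⟩
    cases r <;> simp [step_config, program, nodeStore, giveUp]
  | true, false :: vs, h₃, hl =>
    refine .inr ⟨by simp, vs, by simp at hl; omega, (h₃.tail ?_).mono ht⟩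
    cases r <;> simp [step_config, program, nodeStore, giveUp]
  | true, true :: v :: vs, h₃, hl =>
    refine .inr ⟨by simp, vs, by simp at hl; omega, (h₃.tail ?_).mono ht⟩
    cases r <;> simp [step_config, program, nodeStore, giveUp]
  | false, vs, h₃, hl =>
    refine .inr ⟨by simp, vs, hl, (h₃.tail ?_).mono ht⟩
    cases r <;> simp [step_config, program, nodeStore, giveUp]

end Search

/-! ### Correctness and running time of the search -/

section Decide

open TM2 TM2.Stmt

variable {Γ : Type} [Finite Γ] {c : TM2ComputableAux FormulaSymbol Γ}

theorem reaches_giveUp {N : ℕ} (w ψ : List FormulaSymbol) (x vs : List Bool) (L : List Γ)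
    (us : List (List Γ)) (r : Bool) (hw : w.length ≤ N) (hψ : ψ.length ≤ N) (hx : x.length ≤ N)
    (hv : vs.length ≤ N) (hL : L.length ≤ N) (hk : (encodeKnown us).length ≤ N) :
    ReachesWithin (step (code c)) (4 * N + 4)
      (config c (if r then .wipe (.reply false) else .record) (nodeStore w ψ x vs L us))
      (if r then haltConfig c false
        else config c (.scan true none) (startStore w w [] (L.reverse :: us))) := by
  cases r with
  | true => exact (reaches_reply w ψ x vs L us false hw hψ hx hv hL hk).mono (by omega)
  | false => exact reaches_restart w ψ x vs L us hw hψ hx hv hL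

/-- The machine `c` computes `g` on strings of length at most `n`, and both its running time and
the length of its output are at most `N`. -/
def ComputesUpTo (c : TM2ComputableAux FormulaSymbol Γ) (g : List FormulaSymbol → List Γ)
    (n N : ℕ) : Prop :=
  ∀ χ : List FormulaSymbol, χ.length ≤ n → (g χ).length ≤ N ∧
    Nonempty (TM2OutputsInTime c.tm (χ.map c.inputAlphabet.invFun)
      (some ((g χ).map c.outputAlphabet.invFun)) N)

/-- One step of the descent: the machine accepts at a true leaf, moves to a child whose label is
not known, or gives up `ψ`. -/
theorem reaches_descend {g : List FormulaSymbol → List Γ} {w ψ : List FormulaSymbol}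
    {L : List Γ} {us : List (List Γ)} {N : ℕ} (r : Bool) (hg : ComputesUpTo c g w.length N)
    (hw : w.length ≤ N) (hψ : ψ.length ≤ w.length) (hL : L.length ≤ N)
    (hk : (encodeKnown us).length ≤ N) (hus : ∀ χ, (g χ).reverse ∈ us → χ ∉ SAT) :
    (ψ ∈ SAT ∧ ReachesWithin (step (code c)) (40 * (N + 1) ^ 2)
      (config c (.scan r none) (startStore w ψ L us)) (haltConfig c true)) ∨
    (∃ x b, firstVar (tokenize ψ).2 = some x ∧ (g (substString x b ψ)).reverse ∉ us ∧
      ReachesWithin (step (code c)) (40 * (N + 1) ^ 2)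
        (config c (.scan r none) (startStore w ψ L us))
        (config c (.scan false none)
          (startStore w (substString x b ψ) (g (substString x b ψ)) us))) ∨
    (ψ ∉ SAT ∧ ReachesWithin (step (code c)) (40 * (N + 1) ^ 2)
      (config c (.scan r none) (startStore w ψ L us))
      (if r then haltConfig c false
        else config c (.scan true none) (startStore w w [] (L.reverse :: us)))) := by
  classical
  have hN := hψ.trans hw
  cases h : firstVar (tokenize ψ).2 with
  | none =>
    rcases reaches_leaf (c := c) w ψ L us r h hN with ⟨hs, h₁⟩ | ⟨hs, vs, hvs, h₁⟩
    · refine .inl ⟨hs, (h₁.trans (reaches_reply w ψ [] [] L us true hw hN (Nat.zero_le _)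
        (Nat.zero_le _) hL hk)).mono ?_⟩
      nlinarith
    · refine .inr (.inr ⟨hs, (h₁.trans (reaches_giveUp w ψ [] vs L us r hw hN (Nat.zero_le _)
        hvs hL hk)).mono ?_⟩)
      nlinarith
  | some x =>
    have hx := (length_le_of_firstVar h).trans hN
    have h₁ := reaches_node (c := c) w ψ L us r h hN
    have hχ : ∀ b, (substString x b ψ).length ≤ w.length := fun b =>
      (length_substString_le x b ψ).trans hψ
    have look : ∀ b, ReachesWithin (step (code c)) (12 * (N + 1) ^ 2)
        (config c (.subst r b) (nodeStore w ψ x [] L us))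
        (config c (if (g (substString x b ψ)).reverse ∈ us then .drop r b else .wipe .enter)
        { nodeStore w ψ x [] L us with
          child := substString x b ψ, label := (g (substString x b ψ)).reverse }) := by
      intro b
      obtain ⟨hl, ⟨hM⟩⟩ := hg _ (hχ b)
      exact reaches_lookup hM L us r hN hx le_rfl hl hk
    have enter : ∀ b, (g (substString x b ψ)).reverse ∉ us →
        ReachesWithin (step (code c)) (12 * (N + 1) ^ 2 + (2 * N + 2))
        (config c (.subst r b) (nodeStore w ψ x [] L us))
        (config c (.scan false none)
          (startStore w (substString x b ψ) (g (substString x b ψ)) us)) := by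
      intro b hb
      have h₂ := look b
      rw [if_neg hb] at h₂
      have h₃ := h₂.trans (reaches_enter w ψ _ x L _ us hN hx hL (by simpa using (hg _ (hχ b)).1))
      exact h₃.congr (by simp) le_rfl
    have drop : ∀ b, (g (substString x b ψ)).reverse ∈ us →
        ReachesWithin (step (code c)) (12 * (N + 1) ^ 2 + (N + 1))
        (config c (.subst r b) (nodeStore w ψ x [] L us))
        (config c (if b then (if r then .wipe (.reply false) else .record) else .subst r true)
          (nodeStore w ψ x [] L us)) := by
      intro b hb
      have h₂ := look b
      rw [if_pos hb] at h₂
      exact h₂.trans (reaches_drop w ψ _ x L _ us r b ((hχ b).trans hw)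
        (by simpa using (hg _ (hχ b)).1))
    by_cases h0 : (g (substString x false ψ)).reverse ∈ us
    · have h₂ := h₁.trans (drop false h0)
      by_cases h1 : (g (substString x true ψ)).reverse ∈ us
      -- Both children have known labels, hence are unsatisfiable, and by self-reducibility so is
      -- `ψ`.
      · refine .inr (.inr ⟨fun hs => ?_, ?_⟩)
        · obtain ⟨b, hb⟩ := exists_substString_mem_SAT x hs
          cases b
          · exact hus _ h0 hb
          · exact hus _ h1 hb
        · refine ((h₂.trans (drop true h1)).trans (reaches_giveUp w ψ x [] L us r hw hN hx
            (Nat.zero_le _) hL hk)).mono ?_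
          nlinarith
      · exact .inr (.inl ⟨x, true, rfl, h1, (h₂.trans (enter true h1)).mono (by nlinarith)⟩)
    · exact .inr (.inl ⟨x, false, rfl, h0, (h₁.trans (enter false h0)).mono (by nlinarith)⟩)

/-- The known labels are distinct, and they are the reversals of short strings of `S`. -/
structure Admissible (S : Language Γ) (B : ℕ) (us : List (List Γ)) : Prop where
  nodup : us.Nodup
  mem : ∀ y ∈ us, y.reverse ∈ S
  length_le : ∀ y ∈ us, y.length ≤ B

/-- Reversal is injective, so a duplicate-free list yields equally many elements of `S` of length at
most `B`. -/
theorem Admissible.card_le {S : Language Γ} {B C : ℕ} {us : List (List Γ)}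
    (h : Admissible S B us) (hS : {x : List Γ | x ∈ S ∧ x.length ≤ B}.encard ≤ C) :
    us.length ≤ C := by
  classical
  have hsub : ((us.map List.reverse).toFinset : Set (List Γ)) ⊆
      {x : List Γ | x ∈ S ∧ x.length ≤ B} := by
    intro x hx
    obtain ⟨y, hy, rfl⟩ : ∃ y ∈ us, y.reverse = x := by simpa using hx
    exact ⟨h.mem y hy, by simpa using h.length_le y hy⟩
  have h₁ := (Set.encard_le_encard hsub).trans hS
  rw [Set.encard_coe_eq_coe_finsetCard, List.toFinset_card_of_nodup
    (h.nodup.map List.reverse_injective), List.length_map] at h₁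
  exact_mod_cast h₁

theorem length_encodeKnown_le {B : ℕ} (us : List (List Γ)) (h : ∀ y ∈ us, y.length ≤ B) :
    (encodeKnown us).length ≤ us.length * (B + 1) := by
  induction us with
  | nil => simp [encodeKnown]
  | cons y us ih =>
    have h₁ := ih fun y hy => h y (List.mem_cons_of_mem _ hy)
    have h₂ := h y (List.mem_cons_self ..)
    have e : encodeKnown (y :: us) = none :: (y.map some ++ encodeKnown us) := rfl
    simp only [e, List.length_cons, List.length_append, List.length_map]
    rw [Nat.succ_mul]
    omega

/-- A descent halts with the right answer or finds a new label of an unsatisfiable string. -/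
theorem reaches_round {S : Language Γ} {g : List FormulaSymbol → List Γ} {w : List FormulaSymbol}
    {us : List (List Γ)} {B N : ℕ} (hS : ∀ x, x ∈ SATᶜ ↔ g x ∈ S)
    (hg : ComputesUpTo c g w.length N) (hB : ∀ χ : List FormulaSymbol, χ.length ≤ w.length →
      (g χ).length ≤ B) (hBN : B ≤ N)
    (hw : w.length ≤ N) (hus : Admissible S B us) (hk : (encodeKnown us).length ≤ N) :
    ∀ (n : ℕ) (r : Bool) (ψ : List FormulaSymbol) (L : List Γ), varCount (tokenize ψ).2 < n →
    ψ.length ≤ w.length → (ψ ∈ SAT → w ∈ SAT) → (r = true → ψ = w ∧ L = []) →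
    (r = false → L = g ψ ∧ (g ψ).reverse ∉ us) →
    (∃ a, (a = true ↔ w ∈ SAT) ∧ ReachesWithin (step (code c)) (n * (40 * (N + 1) ^ 2))
      (config c (.scan r none) (startStore w ψ L us)) (haltConfig c a)) ∨
    (∃ y, Admissible S B (y :: us) ∧
      ReachesWithin (step (code c)) (n * (40 * (N + 1) ^ 2))
      (config c (.scan r none) (startStore w ψ L us))
      (config c (.scan true none) (startStore w w [] (y :: us)))) := by
  have sound : ∀ χ, (g χ).reverse ∈ us → χ ∉ SAT := fun χ hχ =>
    (hS χ).2 (by simpa using hus.mem _ hχ)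
  intro n
  induction n with
  | zero => intro r ψ L h; exact absurd h (Nat.not_lt_zero _)
  | succ n ih =>
    intro r ψ L hn hψ hsat hroot hinner
    have hLB : L.length ≤ B := by
      cases r with
      | true => simp [(hroot rfl).2]
      | false => exact (hinner rfl).1 ▸ hB ψ hψ
    have ht : 40 * (N + 1) ^ 2 ≤ (n + 1) * (40 * (N + 1) ^ 2) :=
      Nat.le_mul_of_pos_left _ (Nat.succ_pos n)
    rcases reaches_descend r hg hw hψ (hLB.trans hBN) hk sound with
      ⟨hs, h₁⟩ | ⟨x, b, hx, hb, h₁⟩ | ⟨hs, h₁⟩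
    · exact .inl ⟨true, by simp [hsat hs], h₁.mono ht⟩
    · have e : 40 * (N + 1) ^ 2 + n * (40 * (N + 1) ^ 2) ≤ (n + 1) * (40 * (N + 1) ^ 2) :=
        le_of_eq (by ring)
      have hc : varCount (tokenize (substString x b ψ)).2 < n := by
        rw [tokenize_substString]
        exact (varCount_subst_lt hx b).trans_le (Nat.le_of_lt_succ hn)
      rcases ih false (substString x b ψ) (g (substString x b ψ)) hc
        ((length_substString_le x b ψ).trans hψ) (fun h => hsat (mem_SAT_of_substString h))
        (by simp) (fun _ => ⟨rfl, hb⟩) with ⟨a, ha, h₂⟩ | ⟨y, hy, h₂⟩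
      · exact .inl ⟨a, ha, (h₁.trans h₂).mono e⟩
      · exact .inr ⟨y, hy, (h₁.trans h₂).mono e⟩
    -- An unsatisfiable root settles the answer. Below the root, `ψ` was entered because its label
    -- was not in `us`, so recording that label keeps the list free of duplicates.
    · cases r with
      | true => exact .inl ⟨false, by simpa [(hroot rfl).1] using hs, h₁.mono ht⟩
      | false =>
        obtain ⟨rfl, hnot⟩ := hinner rfl
        refine .inr ⟨(g ψ).reverse, ⟨List.nodup_cons.2 ⟨hnot, hus.nodup⟩, ?_, ?_⟩, h₁.mono ht⟩
        · refine List.forall_mem_cons.2 ⟨?_, hus.mem⟩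
          simpa using (hS ψ).1 hs
        · exact List.forall_mem_cons.2 ⟨by simpa using hB ψ hψ, hus.length_le⟩

/-- From any admissible list of known labels, the machine halts with the right answer. -/
theorem reaches_answer {S : Language Γ} {g : List FormulaSymbol → List Γ} {w : List FormulaSymbol}
    {B C N : ℕ} (hS : ∀ x, x ∈ SATᶜ ↔ g x ∈ S)
    (hg : ComputesUpTo c g w.length N) (hB : ∀ χ : List FormulaSymbol, χ.length ≤ w.length →
      (g χ).length ≤ B) (hBN : B ≤ N) (hw : w.length ≤ N)
    (hC : {x : List Γ | x ∈ S ∧ x.length ≤ B}.encard ≤ C) (hCN : C * (B + 1) ≤ N) :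
    ∀ (n : ℕ) (us : List (List Γ)), Admissible S B us → C < n + us.length →
    ∃ a, (a = true ↔ w ∈ SAT) ∧
      ReachesWithin (step (code c)) (n * ((N + 1) * (40 * (N + 1) ^ 2)))
      (config c (.scan true none) (startStore w w [] us)) (haltConfig c a) := by
  intro n
  induction n with
  -- With no descents left, the list would hold more than `C` distinct labels.
  | zero =>
    intro us hus h
    have := hus.card_le hC
    omega
  | succ n ih =>
    intro us hus h
    have hk : (encodeKnown us).length ≤ N :=
      (length_encodeKnown_le us hus.length_le).trans
        ((Nat.mul_le_mul_right _ (hus.card_le hC)).trans hCN)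
    have hv : varCount (tokenize w).2 < N + 1 :=
      Nat.lt_succ_of_le ((varCount_le w).trans hw)
    rcases reaches_round hS hg hB hBN hw hus hk (N + 1) true w [] hv le_rfl id
      (fun _ => ⟨rfl, rfl⟩) (by simp) with ⟨a, ha, h₁⟩ | ⟨y, hy, h₁⟩
    · exact ⟨a, ha, h₁.mono (Nat.le_mul_of_pos_left _ (Nat.succ_pos n))⟩
    · obtain ⟨a, ha, h₂⟩ := ih _ hy (by simp; omega)
      exact ⟨a, ha, (h₁.trans h₂).mono (le_of_eq (by ring))⟩

/-- Two passes copy the input to `child` while keeping it for restarts. From the empty list, `C + 1`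
descents suffice. -/
theorem reaches_haltConfig {S : Language Γ} {g : List FormulaSymbol → List Γ}
    {w : List FormulaSymbol} {B C N : ℕ} (hS : ∀ x, x ∈ SATᶜ ↔ g x ∈ S)
    (hg : ComputesUpTo c g w.length N) (hB : ∀ χ : List FormulaSymbol, χ.length ≤ w.length →
      (g χ).length ≤ B) (hBN : B ≤ N) (hw : w.length ≤ N)
    (hC : {x : List Γ | x ∈ S ∧ x.length ≤ B}.encard ≤ C) (hCN : C * (B + 1) ≤ N) :
    ∃ a, (a = true ↔ w ∈ SAT) ∧
      ReachesWithin (step (code c)) (2 * N + 2 + (C + 1) * ((N + 1) * (40 * (N + 1) ^ 2)))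
      (config c .unload { input := w }) (haltConfig c a) := by
  obtain ⟨a, ha, h⟩ := reaches_answer hS hg hB hBN hw hC hCN (C + 1) []
    ⟨List.nodup_nil, by simp, by simp⟩ (by simp)
  refine ⟨a, ha, ?_⟩
  have h₁ := (unload_loop (c := c) w { input := w } rfl).trans (reload_loop _ _ rfl)
  refine (ReachesWithin.trans (h₁.congr ?_ ?_) h)
  · simp [startStore, encodeKnown]
  · simp; omega

theorem initList_machine (w : List FormulaSymbol) :
    initList (machine c) w = config c .unload { input := w } := by
  have h : Function.update (β := fun k => List (StackAlphabet c k)) (fun _ => []) (.inl .input) w =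
      allStacks c { input := w } (fun _ => []) := by
    funext k
    rcases k with k | k
    · cases k <;> rfl
    · rfl
  exact (initList_eq (machine c) w).trans
    (congrArg (fun S => (⟨some (.inl .unload), (none, c.tm.initialState), S⟩ : Config c)) h)

theorem haltList_machine (a : Bool) : haltList (machine c) [a] = haltConfig c a := by
  have h : Function.update (β := fun k => List (StackAlphabet c k)) (fun _ => []) (.inl .output)
      [a] = allStacks c { output := [a] } (fun _ => []) := by
    funext k
    rcases k with k | k
    · cases k <;> rfl
    · rfl
  exact (haltList_eq (machine c) [a]).trans
    (congrArg (fun S => (⟨none, (none, c.tm.initialState), S⟩ : Config c)) h)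

/-- Natural coefficients make the polynomial monotone, so time bounds at `|w|` also cover the
shorter strings met in the search. -/
theorem eval_le_eval (p : Polynomial ℕ) {m n : ℕ} (h : m ≤ n) : p.eval m ≤ p.eval n := by
  rw [Polynomial.eval_eq_sum, Polynomial.eval_eq_sum]
  exact Finset.sum_le_sum fun i _ => Nat.mul_le_mul_left _ (Nat.pow_le_pow_left h i)

theorem inP_SAT_of_sparse {S : Language Γ} (hsparse : Sparse S)
    (h : PolyManyOneReducible SATᶜ S) : InP SAT := by
  classical
  obtain ⟨g, ⟨G⟩, hS⟩ := h
  obtain ⟨q, hq⟩ := hsparse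
  let d := ∑ l, pushCount (G.tm.m l)
  -- `pB` bounds the length of a label and `pC` the census of `S` up to that length. `pN` bounds at
  -- once the input, one run of the reduction, a label and the written list of known labels; `pT` is
  -- the total time.
  let pB : Polynomial ℕ := Polynomial.X + G.time * Polynomial.C d
  let pC : Polynomial ℕ := q.comp pB
  let pN : Polynomial ℕ := Polynomial.X + G.time + pB + pC * (pB + 1)
  let pT : Polynomial ℕ := 2 * pN + 2 + (pC + 1) * ((pN + 1) * (40 * (pN + 1) ^ 2))
  have main : ∀ w : List FormulaSymbol, ∃ a, (a = true ↔ w ∈ SAT) ∧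
      ReachesWithin (step (code G.toTM2ComputableAux)) (pT.eval w.length)
        (config _ .unload { input := w }) (haltConfig _ a) := by
    intro w
    have eB : pB.eval w.length = w.length + G.time.eval w.length * d := by simp [pB]
    have eC : pC.eval w.length = q.eval (pB.eval w.length) := by simp [pC]
    have eN : pN.eval w.length = w.length + G.time.eval w.length + pB.eval w.length +
        pC.eval w.length * (pB.eval w.length + 1) := by simp [pN]
    have eT : pT.eval w.length = 2 * pN.eval w.length + 2 + (pC.eval w.length + 1) *
        ((pN.eval w.length + 1) * (40 * (pN.eval w.length + 1) ^ 2)) := by simp [pT]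
    have hB : ∀ χ : List FormulaSymbol, χ.length ≤ w.length →
        (g χ).length ≤ pB.eval w.length := by
      intro χ hχ
      have h₁ := length_output_le G.tm (G.outputsFun χ)
      simp only [List.length_map, id] at h₁
      have h₂ := Nat.mul_le_mul_right d (eval_le_eval G.time hχ)
      rw [eB]
      exact h₁.trans (Nat.add_le_add hχ h₂)
    rw [eT]
    refine reaches_haltConfig (B := pB.eval w.length) hS ?_ hB ?_ ?_ (eC ▸ hq _) ?_
    · intro χ hχ
      refine ⟨(hB χ hχ).trans (by omega), ⟨⟨(G.outputsFun χ).toEvalsTo, ?_⟩⟩⟩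
      refine (G.outputsFun χ).steps_le_m.trans ((eval_le_eval G.time hχ).trans ?_)
      omega
    all_goals omega
  choose f hf hrun using main
  choose n hn hsteps using hrun
  refine ⟨f, hf, ⟨⟨⟨machine G.toTM2ComputableAux, Equiv.refl _, Equiv.refl _⟩, pT, fun w => ?_⟩⟩⟩
  refine ⟨⟨n w, ?_⟩, hn w⟩
  have h₁ := (congrArg (initList (machine G.toTM2ComputableAux)) (List.map_id w)).trans
    (initList_machine w)
  have h₂ := haltList_machine (c := G.toTM2ComputableAux) (f w)
  exact (congrArg (fun a =>
    (flip bind (machine G.toTM2ComputableAux).step)^[n w] (some a)) h₁).trans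
    ((hsteps w).trans (congrArg some h₂.symm))

end Decide

end SparseSat

theorem mainTheorem3 {Γ : Type} [Finite Γ]
    (h : ∃ S : Language Γ, SparseSat.Sparse S ∧
      SparseSat.PolyManyOneReducible (SparseSat.SAT)ᶜ S) :
    SparseSat.InP SparseSat.SAT := by
  obtain ⟨S, hS, hred⟩ := h
  exact SparseSat.inP_SAT_of_sparse hS hred
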